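/- \textbf{Theorem.} Let $(G,g)$ be a Riemannian Lie group, i.e. a (finite-dimensional, real) Lie group $G$ with a left-invariant Riemannian metric $g$. Let $K$ be a closed normal Lie subgroup of $G$ which is semisimple, i.e. whose Lie algebra is semisimple. (The left cosets of $K$ then form a left-invariant foliation of $G$.) Let $\phi:G\to G/K$ be the natural projection onto the quotient Lie group, whose smooth structure is the one for which $\phi$ is a smooth submersion. Then there is a unique Riemannian metric $h$ on $G/K$ such that $\phi:(G,g)\to(G/K,h)$ is a Riemannian submersion, i.e. such that $d\phi_x$ is surjective and restricts to an isometry from $(\ker d\phi_x)^{\perp}$ onto $T_{\phi(x)}(G/K)$ for every $x\in G$; and with respect to this metric $\phi$ is a harmonic morphism, i.e. $\phi$ is smooth, and for every open $U\subseteq G/K$ with $\phi^{-1}(U)\neq\emptyset$ and every smooth $f:U\to\mathbb R$ with $\Delta_h f=0$ on $U$ one has $\Delta_g(f\circ\phi)=0$ on $\phi^{-1}(U)$. Here $\Delta$ denotes the Laplace--Beltrami operator. -/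

import Mathlib

open scoped Manifold ContDiff

noncomputable section

/-- A real Lie group of class `C^∞` is in particular a Lie group of the finite smoothness class
which Mathlib uses to define the Lie bracket on its tangent space at the identity. -/
instance LieGroup.minSmoothness_three_of_infty {E H G : Type*} [NormedAddCommGroup E]
    [NormedSpace ℝ E] [TopologicalSpace H] {I : ModelWithCorners ℝ E H}
    [TopologicalSpace G] [ChartedSpace H G] [Group G] [LieGroup I ∞ G] :
    LieGroup I (minSmoothness ℝ 3) G := by
  rw [minSmoothness_of_isRCLikeNormedField]
  infer_instance

namespace RiemannianLie

/-- A smooth Riemannian metric on an `m`-dimensional smooth manifold `M`. -/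
abbrev Metric (m : ℕ) (M : Type*) [TopologicalSpace M]
    [ChartedSpace (EuclideanSpace ℝ (Fin m)) M] [IsManifold (𝓡 m) ∞ M] : Type _ :=
  Bundle.ContMDiffRiemannianMetric (𝓡 m) ∞ (EuclideanSpace ℝ (Fin m))
    (fun x : M ↦ TangentSpace (𝓡 m) x)

/-- The partial derivative `∂ᵢ u` of a function on `ℝᵐ`. -/
def partialDeriv {m : ℕ} (i : Fin m) (u : EuclideanSpace ℝ (Fin m) → ℝ)
    (y : EuclideanSpace ℝ (Fin m)) : ℝ :=
  fderiv ℝ u y (EuclideanSpace.single i 1)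

section Laplacian

variable {m : ℕ} {M : Type*} [TopologicalSpace M]
  [ChartedSpace (EuclideanSpace ℝ (Fin m)) M] [IsManifold (𝓡 m) ∞ M]

/-- The coordinate vector field `∂ᵢ` of the chart at `p`, at the point with coordinates `y`. -/
def coordVector (p : M) (y : EuclideanSpace ℝ (Fin m)) (i : Fin m) :
    TangentSpace (𝓡 m) ((extChartAt (𝓡 m) p).symm y) :=
  mfderiv (𝓡 m) (𝓡 m) (extChartAt (𝓡 m) p).symm y (EuclideanSpace.single i (1 : ℝ))

/-- The matrix `g_{ij} = g(∂ᵢ, ∂ⱼ)` of the metric in the chart at `p`, at the point with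
coordinates `y`. -/
def gram (g : Metric m M) (p : M) (y : EuclideanSpace ℝ (Fin m)) : Matrix (Fin m) (Fin m) ℝ :=
  Matrix.of fun i j ↦
    g.inner ((extChartAt (𝓡 m) p).symm y) (coordVector p y i) (coordVector p y j)

/-- The Christoffel symbol `Γᵏᵢⱼ = ½ ∑ₗ gᵏˡ (∂ᵢ gⱼₗ + ∂ⱼ gᵢₗ - ∂ₗ gᵢⱼ)` of the Levi-Civita
connection in the chart at `p`. -/
def christoffel (g : Metric m M) (p : M) (i j k : Fin m) (y : EuclideanSpace ℝ (Fin m)) : ℝ :=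
  (1 / 2 : ℝ) * ∑ l, (gram g p y)⁻¹ k l *
    (partialDeriv i (fun z ↦ gram g p z j l) y + partialDeriv j (fun z ↦ gram g p z i l) y
      - partialDeriv l (fun z ↦ gram g p z i j) y)

/-- The Laplace-Beltrami operator `Δf = trace_g (∇df) = ∑ᵢⱼ gⁱʲ (∂ᵢ∂ⱼ f - ∑ₖ Γᵏᵢⱼ ∂ₖ f)` at `p`,
computed in the chart at `p`. -/
def laplacian (g : Metric m M) (f : M → ℝ) (p : M) : ℝ :=
  let u : EuclideanSpace ℝ (Fin m) → ℝ := f ∘ (extChartAt (𝓡 m) p).symm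
  let y : EuclideanSpace ℝ (Fin m) := extChartAt (𝓡 m) p p
  ∑ i, ∑ j, (gram g p y)⁻¹ i j *
    (partialDeriv i (partialDeriv j u) y - ∑ k, christoffel g p i j k y * partialDeriv k u y)

/-- `f` is a harmonic function on the set `U` (in the applications, an open set). -/
structure IsHarmonicOn (g : Metric m M) (f : M → ℝ) (U : Set M) : Prop where
  contMDiffOn : ContMDiffOn (𝓡 m) 𝓘(ℝ, ℝ) ∞ f U
  laplacian_eq_zero : ∀ p ∈ U, laplacian g f p = 0

end Laplacian

section Maps

variable {m n : ℕ} {M N : Type*}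
  [TopologicalSpace M] [ChartedSpace (EuclideanSpace ℝ (Fin m)) M] [IsManifold (𝓡 m) ∞ M]
  [TopologicalSpace N] [ChartedSpace (EuclideanSpace ℝ (Fin n)) N] [IsManifold (𝓡 n) ∞ N]

/-- A harmonic morphism: a smooth map which pulls back local harmonic functions
to local harmonic functions. -/
structure IsHarmonicMorphism (g : Metric m M) (h : Metric n N) (φ : M → N) : Prop where
  contMDiff : ContMDiff (𝓡 m) (𝓡 n) ∞ φ
  comp_isHarmonicOn : ∀ U : Set N, IsOpen U → (φ ⁻¹' U).Nonempty → ∀ f : N → ℝ,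
    IsHarmonicOn h f U → IsHarmonicOn g (f ∘ φ) (φ ⁻¹' U)

/-- A Riemannian submersion: a smooth submersion whose differential is isometric on
the horizontal spaces, the orthogonal complements of the kernels of the differential. -/
structure IsRiemannianSubmersion (g : Metric m M) (h : Metric n N) (φ : M → N) : Prop where
  contMDiff : ContMDiff (𝓡 m) (𝓡 n) ∞ φ
  surjective_mfderiv : ∀ x, Function.Surjective (mfderiv (𝓡 m) (𝓡 n) φ x)
  isometric : ∀ (x : M) (v w : TangentSpace (𝓡 m) x),
    (∀ u : TangentSpace (𝓡 m) x, mfderiv (𝓡 m) (𝓡 n) φ x u = 0 → g.inner x v u = 0) →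
    (∀ u : TangentSpace (𝓡 m) x, mfderiv (𝓡 m) (𝓡 n) φ x u = 0 → g.inner x w u = 0) →
    h.inner (φ x) (mfderiv (𝓡 m) (𝓡 n) φ x v) (mfderiv (𝓡 m) (𝓡 n) φ x w) = g.inner x v w

end Maps

/-- A Riemannian metric on a Lie group is left-invariant if all left translations are
isometries. -/
def IsLeftInvariant {m : ℕ} {G : Type*} [TopologicalSpace G]
    [ChartedSpace (EuclideanSpace ℝ (Fin m)) G] [Group G] [LieGroup (𝓡 m) ∞ G]
    (g : Metric m G) : Prop :=
  ∀ (a x : G) (v w : TangentSpace (𝓡 m) x),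
    g.inner (a * x) (mfderiv (𝓡 m) (𝓡 m) (fun y : G ↦ a * y) x v)
      (mfderiv (𝓡 m) (𝓡 m) (fun y : G ↦ a * y) x w) = g.inner x v w

/-- A Lie group is semisimple if its Lie algebra is semisimple, that is, if the radical of the
Lie algebra vanishes. -/
def IsSemisimpleLieGroup (d : ℕ) (K : Type*) [TopologicalSpace K]
    [ChartedSpace (EuclideanSpace ℝ (Fin d)) K] [Group K] [LieGroup (𝓡 d) ∞ K] : Prop :=
  LieAlgebra.HasTrivialRadical ℝ (GroupLieAlgebra (𝓡 d) K)

end RiemannianLie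

end

/-! The Laplacian commutes with the projection because its fibres are minimal, and here minimality
is the vanishing of a trace. In an orthonormal frame `X_a` one has `Δf = ∑ₐ X_a X_a f - ∑_b (∑ₐ
g([X_b, X_a], X_a)) X_b f` (`coordLaplacian_eq_frame`, `laplacian_eq_frame`). For a left-invariant
frame the coefficient of `X_b` is the constant `tr (ad X_b)`.

Choose the frame adapted to the projection: some vectors horizontal, the others spanning the Lie
algebra `𝔨` of `K`. The vertical vectors annihilate `f ∘ φ`, and the horizontal ones are `φ`-related
to an orthonormal left-invariant frame of the quotient, brackets included. Thus `Δ_g (f ∘ φ)` and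
`(Δ_h f) ∘ φ` differ only by first-order terms, whose coefficients are the traces of `ad X` on the
ideal `𝔨` with `X` horizontal (`IsRiemannianSubmersion.laplacian_comp`). Such a restriction is a
derivation of `𝔨`. As `𝔨` is semisimple, the derivation is inner, and `𝔨 = [𝔨, 𝔨]` makes every inner
derivation traceless (`LieAlgebra.sum_bilin_lie_eq_zero`).

The metric `h` comes from transporting the inner product on horizontal vectors at the identity and
extending it left-invariantly. Left invariance of `g` makes one condition on Lie algebra vectors
express the Riemannian submersion property at every point (`isRiemannianSubmersion_iff`). Uniqueness
holds because every tangent vector of the quotient has a horizontal lift. The identification of `𝔨`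
with the kernel of the differential (`mem_range_lieMap_iff`) rests on the local normal forms of
submersions and immersions. -/

/-! ### Traces in semisimple Lie algebras, and adapted orthonormal bases -/

/-- In a finite-dimensional real Lie algebra with trivial radical, all adjoint maps are
traceless. -/
lemma LieAlgebra.trace_ad_eq_zero_of_hasTrivialRadical {L : Type*} [LieRing L] [LieAlgebra ℝ L]
    [Module.Finite ℝ L] [LieAlgebra.HasTrivialRadical ℝ L] (x : L) :
    LinearMap.trace ℝ L (LieAlgebra.ad ℝ L x : Module.End ℝ L) = 0 := by
  let I : LieIdeal ℝ L := ⁅(⊤ : LieIdeal ℝ L), (⊤ : LieIdeal ℝ L)⁆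
  have hc : IsCompl I (LieIdeal.killingCompl ℝ L I) := LieIdeal.isCompl_killingCompl I
  -- The bracket of the Killing complement with itself lies both in the derived ideal and in the
  -- complement, hence is zero. An abelian ideal is solvable, so trivial radical kills it and the
  -- algebra is perfect.
  have hab : IsLieAbelian (LieIdeal.killingCompl ℝ L I) := by
    rw [LieSubmodule.lie_abelian_iff_lie_self_eq_bot, eq_bot_iff, ← hc.inf_eq_bot]
    exact le_inf (LieSubmodule.mono_lie le_top le_top) (LieSubmodule.lie_le_right _ _)
  have hbot := LieAlgebra.HasTrivialRadical.eq_bot_of_isSolvable (R := ℝ)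
    (LieIdeal.killingCompl ℝ L I)
  have htop : I = ⊤ := by simpa [hbot] using hc.sup_eq_top
  apply LieModule.trace_toEnd_eq_zero_of_mem_lcs ℝ L L (k := 1) le_rfl
  have : LieModule.lowerCentralSeries ℝ L L 1 = I := by
    simp [I, LieModule.lowerCentralSeries_succ]
  rw [this, htop]
  trivial

/-- A derivation of a finite-dimensional real Lie algebra with trivial radical is traceless. -/
lemma LieDerivation.trace_eq_zero_of_hasTrivialRadical {L : Type*} [LieRing L] [LieAlgebra ℝ L]
    [Module.Finite ℝ L] [LieAlgebra.HasTrivialRadical ℝ L] (D : LieDerivation ℝ L L) :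
    LinearMap.trace ℝ L (D : L →ₗ[ℝ] L) = 0 := by
  obtain ⟨x, rfl⟩ := LieDerivation.IsKilling.exists_eq_ad D
  rw [LieDerivation.coe_ad_apply_eq_ad_apply]
  exact LieAlgebra.trace_ad_eq_zero_of_hasTrivialRadical x

/-- A positive definite symmetric bilinear form on a finite-dimensional space admits an
orthonormal basis adapted to a given subspace and its orthogonal complement. -/
lemma exists_orthonormal_basis_sum {V : Type*} [AddCommGroup V] [Module ℝ V]
    [FiniteDimensional ℝ V] (B : V →ₗ[ℝ] V →ₗ[ℝ] ℝ) (hsymm : ∀ v w, B v w = B w v)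
    (hpos : ∀ v, v ≠ 0 → 0 < B v v) (W : Submodule ℝ V) :
    ∃ (p q : ℕ) (e : Fin p ⊕ Fin q → V), (∀ a b, B (e a) (e b) = if a = b then 1 else 0) ∧
      (∀ v, ∑ a, B v (e a) • e a = v) ∧ (∀ a, e (Sum.inr a) ∈ W) ∧
      ∀ w ∈ W, ∀ a, B w (e (Sum.inl a)) = 0 := by
  -- `B` itself is made the inner product, so that orthonormal bases of `W` and `Wᗮ` can be glued.
  let core : InnerProductSpace.Core ℝ V :=
    { inner := fun v w ↦ B v w
      conj_inner_symm := fun v w ↦ by simpa using hsymm w v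
      re_inner_nonneg := fun v ↦ by
        rcases eq_or_ne v 0 with rfl | h
        · simp
        · simpa using (hpos v h).le
      add_left := fun u v w ↦ by simp
      smul_left := fun v w r ↦ by simp
      definite := fun v h ↦ by
        by_contra hv
        exact (hpos v hv).ne' h }
  let _ : NormedAddCommGroup V := core.toNormedAddCommGroup
  let _ : InnerProductSpace ℝ V := InnerProductSpace.ofCore core.toCore
  have hin : ∀ v w : V, inner ℝ v w = B v w := fun _ _ ↦ rfl
  let b₁ := stdOrthonormalBasis ℝ Wᗮ
  let b₂ := stdOrthonormalBasis ℝ W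
  let e : Fin (Module.finrank ℝ Wᗮ) ⊕ Fin (Module.finrank ℝ W) → V :=
    Sum.elim (fun a ↦ (b₁ a : V)) (fun a ↦ (b₂ a : V))
  refine ⟨_, _, e, ?_, ?_, fun a ↦ (b₂ a).2, fun w hw a ↦ (b₁ a).2 w hw⟩
  · have h₁ := orthonormal_iff_ite.1 b₁.orthonormal
    have h₂ := orthonormal_iff_ite.1 b₂.orthonormal
    rintro (a | a) (b | b)
    · simpa [e, ← hin] using h₁ a b
    · simpa [e, ← hin] using (hsymm _ _).trans ((b₁ a).2 _ (b₂ b).2)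
    · simpa [e, ← hin] using (b₁ b).2 _ (b₂ a).2
    · simpa [e, ← hin] using h₂ a b
  · intro v
    obtain ⟨w, hw, z, hz, rfl⟩ := W.exists_add_mem_mem_orthogonal v
    have h₁ := congrArg (Subtype.val) (b₁.sum_repr' ⟨z, hz⟩)
    have h₂ := congrArg (Subtype.val) (b₂.sum_repr' ⟨w, hw⟩)
    have o₁ : ∀ a, B w (b₁ a) = 0 := fun a ↦ (b₁ a).2 w hw
    have o₂ : ∀ a, B z (b₂ a) = 0 := fun a ↦ (hsymm _ _).trans (hz _ (b₂ a).2)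
    simp only [Submodule.coe_inner, AddSubmonoidClass.coe_finsetSum, Submodule.coe_smul, hin,
      hsymm _ z, hsymm _ w] at h₁ h₂
    simp [e, o₁, o₂, h₁, h₂, add_comm]

namespace RiemannianLie

/-! ### The Laplacian in coordinates and in an orthonormal frame -/

section Frame

variable {m : ℕ}

/-- The bilinear form on `ℝᵐ` with a given matrix. -/
noncomputable def matrixForm (A : Matrix (Fin m) (Fin m) ℝ) :
    EuclideanSpace ℝ (Fin m) →ₗ[ℝ] EuclideanSpace ℝ (Fin m) →ₗ[ℝ] ℝ :=
  LinearMap.mk₂ ℝ (fun v w ↦ ∑ i, ∑ j, A i j * v i * w j)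
    (fun u v w ↦ by simp [mul_add, add_mul, Finset.sum_add_distrib])
    (fun c v w ↦ by simp [Finset.mul_sum, mul_assoc, mul_left_comm])
    (fun u v w ↦ by simp [mul_add, Finset.sum_add_distrib])
    (fun c v w ↦ by simp [Finset.mul_sum, mul_left_comm])

lemma matrixForm_apply (A : Matrix (Fin m) (Fin m) ℝ) (v w : EuclideanSpace ℝ (Fin m)) :
    matrixForm A v w = ∑ i, ∑ j, A i j * v i * w j := rfl

lemma matrixForm_comm {A : Matrix (Fin m) (Fin m) ℝ} (hA : ∀ i j, A i j = A j i)
    (v w : EuclideanSpace ℝ (Fin m)) : matrixForm A v w = matrixForm A w v := by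
  rw [matrixForm_apply, matrixForm_apply, Finset.sum_comm]
  refine Finset.sum_congr rfl fun i _ ↦ Finset.sum_congr rfl fun j _ ↦ ?_
  rw [hA j i]
  ring

lemma clm_apply_eq_sum (φ : EuclideanSpace ℝ (Fin m) →L[ℝ] ℝ) (v : EuclideanSpace ℝ (Fin m)) :
    φ v = ∑ i, v i * φ (EuclideanSpace.single i 1) := by
  conv_lhs => rw [← (EuclideanSpace.basisFun (Fin m) ℝ).sum_repr v]
  simp

/-- The derivative of a matrix-valued function in a given direction. -/
noncomputable def matrixDeriv (A : EuclideanSpace ℝ (Fin m) → Matrix (Fin m) (Fin m) ℝ)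
    (y w : EuclideanSpace ℝ (Fin m)) : Matrix (Fin m) (Fin m) ℝ :=
  Matrix.of fun i j ↦ fderiv ℝ (fun z ↦ A z i j) y w

variable {ι : Type*}
  {A : EuclideanSpace ℝ (Fin m) → Matrix (Fin m) (Fin m) ℝ} {y : EuclideanSpace ℝ (Fin m)}
  {X : ι → EuclideanSpace ℝ (Fin m) → EuclideanSpace ℝ (Fin m)}

/-- Expanding the basis vector `e_j` in the frame says that `(∑ₐ X_a X_aᵀ) A = 1`. -/
lemma inv_eq_sum_of_frame [Fintype ι] (hsymm : ∀ i j, A y i j = A y j i)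
    (hspan : ∀ v, ∑ a, matrixForm (A y) v (X a y) • X a y = v) (k l : Fin m) :
    (A y)⁻¹ k l = ∑ a, X a y k * X a y l := by
  have h : (A y)⁻¹ = Matrix.of fun k l ↦ ∑ a, X a y k * X a y l := by
    refine Matrix.inv_eq_left_inv ?_
    ext k j
    have := congrArg (fun v : EuclideanSpace ℝ (Fin m) ↦ v k)
      (hspan (EuclideanSpace.single j 1))
    simp only [WithLp.ofLp_sum, WithLp.ofLp_smul, Finset.sum_apply, Pi.smul_apply, smul_eq_mul,
      matrixForm_apply, PiLp.single_apply, mul_ite, mul_one, mul_zero, ite_mul, zero_mul,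
      Finset.sum_ite_irrel, Finset.sum_const_zero] at this
    rw [Matrix.mul_apply, Matrix.one_apply, ← this]
    simp only [Matrix.of_apply, Finset.sum_mul]
    rw [Finset.sum_comm]
    refine Finset.sum_congr rfl fun a _ ↦ ?_
    rw [Finset.sum_eq_single (a := j) (f := fun i ↦ (if i = j then _ else _) * _)
      (fun i _ hi ↦ by simp [hi]) (by simp)]
    simp only [if_true, Finset.sum_mul]
    refine Finset.sum_congr rfl fun i _ ↦ ?_
    rw [hsymm i j]
    ring
  rw [h, Matrix.of_apply]

/-- Product rule applied to the constant function `A(X_a, X_b)`: it trades derivatives of the metric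
for derivatives of the frame. -/
lemma matrixForm_matrixDeriv_of_frame {a b : ι} {c : ℝ}
    (hA : ∀ i j, DifferentiableAt ℝ (fun z ↦ A z i j) y)
    (ha : DifferentiableAt ℝ (X a) y) (hb : DifferentiableAt ℝ (X b) y)
    (hc : ∀ᶠ z in nhds y, matrixForm (A z) (X a z) (X b z) = c)
    (w : EuclideanSpace ℝ (Fin m)) :
    matrixForm (matrixDeriv A y w) (X a y) (X b y) =
      - matrixForm (A y) (fderiv ℝ (X a) y w) (X b y)
      - matrixForm (A y) (X a y) (fderiv ℝ (X b) y w) := by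
  have hcoord : ∀ {Y : EuclideanSpace ℝ (Fin m) → EuclideanSpace ℝ (Fin m)},
      DifferentiableAt ℝ Y y → ∀ i, HasFDerivAt (fun z ↦ Y z i)
        ((EuclideanSpace.proj i : EuclideanSpace ℝ (Fin m) →L[ℝ] ℝ) ∘L fderiv ℝ Y y) y :=
    fun hY i ↦ (EuclideanSpace.proj i : EuclideanSpace ℝ (Fin m) →L[ℝ] ℝ).hasFDerivAt.comp y
      hY.hasFDerivAt
  have h := HasFDerivAt.fun_sum (u := Finset.univ) fun i _ ↦
    HasFDerivAt.fun_sum (u := Finset.univ) fun j _ ↦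
      ((hA i j).hasFDerivAt.mul (hcoord ha i)).mul (hcoord hb j)
  have h0 := h.unique ((hasFDerivAt_const c y).congr_of_eventuallyEq hc)
  have h1 := congrArg (fun φ : EuclideanSpace ℝ (Fin m) →L[ℝ] ℝ ↦ φ w) h0
  simp only [matrixForm_apply, matrixDeriv, Matrix.of_apply]
  simp only [ContinuousLinearMap.comp_apply, PiLp.proj_apply, sum_apply, add_apply, smul_apply,
    zero_apply, smul_eq_mul, Pi.mul_apply] at h1
  rw [← sub_eq_zero, ← h1]
  simp only [← Finset.sum_sub_distrib, ← Finset.sum_neg_distrib]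
  refine Finset.sum_congr rfl fun i _ ↦ Finset.sum_congr rfl fun j _ ↦ ?_
  ring

/-- Contracting the first two indices with the same vector `v` makes the first two of the three
metric derivatives equal. -/
lemma sum_mul_christoffel_eq (v w : EuclideanSpace ℝ (Fin m)) :
    ∑ i, ∑ j, ∑ l, v i * v j * w l * (partialDeriv i (fun z ↦ A z j l) y
      + partialDeriv j (fun z ↦ A z i l) y - partialDeriv l (fun z ↦ A z i j) y) =
    2 * matrixForm (matrixDeriv A y v) v w - matrixForm (matrixDeriv A y w) v v := by
  have h₁ : ∑ i, ∑ j, ∑ l, v i * v j * w l * partialDeriv i (fun z ↦ A z j l) y =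
      matrixForm (matrixDeriv A y v) v w := by
    rw [matrixForm_apply, Finset.sum_comm]
    refine Finset.sum_congr rfl fun j _ ↦ ?_
    rw [Finset.sum_comm]
    refine Finset.sum_congr rfl fun l _ ↦ ?_
    rw [matrixDeriv, Matrix.of_apply, clm_apply_eq_sum, Finset.sum_mul, Finset.sum_mul]
    refine Finset.sum_congr rfl fun i _ ↦ ?_
    rw [partialDeriv]
    ring
  have h₂ : ∑ i, ∑ j, ∑ l, v i * v j * w l * partialDeriv j (fun z ↦ A z i l) y =
      matrixForm (matrixDeriv A y v) v w := by
    rw [← h₁, Finset.sum_comm]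
    simp only [mul_comm (v _) (v _)]
  have h₃ : ∑ i, ∑ j, ∑ l, v i * v j * w l * partialDeriv l (fun z ↦ A z i j) y =
      matrixForm (matrixDeriv A y w) v v := by
    rw [matrixForm_apply]
    refine Finset.sum_congr rfl fun i _ ↦ Finset.sum_congr rfl fun j _ ↦ ?_
    rw [matrixDeriv, Matrix.of_apply, clm_apply_eq_sum, Finset.sum_mul, Finset.sum_mul]
    refine Finset.sum_congr rfl fun l _ ↦ ?_
    rw [partialDeriv]
    ring
  simp only [mul_add, mul_sub, Finset.sum_add_distrib, Finset.sum_sub_distrib, h₁, h₂, h₃]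
  ring

lemma sum_mul_sum_mul_eq [Fintype ι] (B : ι → Fin m → ℝ) (T U : Fin m → ℝ) :
    ∑ k, ((1 / 2 : ℝ) * ∑ l, (∑ b, B b k * B b l) * T l) * U k =
      ∑ b, (∑ k, B b k * U k) * (1 / 2 * ∑ l, B b l * T l) := by
  simp only [Finset.sum_mul (s := Finset.univ (α := Fin m)) (f := fun k ↦ B _ k * U k)]
  rw [Finset.sum_comm]
  refine Finset.sum_congr rfl fun k _ ↦ ?_
  simp only [Finset.sum_mul, Finset.mul_sum]
  rw [Finset.sum_comm]
  refine Finset.sum_congr rfl fun b _ ↦ Finset.sum_congr rfl fun l _ ↦ ?_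
  ring

/-- The Laplace-Beltrami operator in coordinates, computed in an orthonormal frame. -/
lemma coordLaplacian_eq_frame [Fintype ι] [DecidableEq ι]
    {u : EuclideanSpace ℝ (Fin m) → ℝ}
    (hA : ∀ i j, DifferentiableAt ℝ (fun z ↦ A z i j) y) (hsymm : ∀ i j, A y i j = A y j i)
    (hX : ∀ a, DifferentiableAt ℝ (X a) y)
    (hon : ∀ a b, ∀ᶠ z in nhds y, matrixForm (A z) (X a z) (X b z) = if a = b then 1 else 0)
    (hspan : ∀ v, ∑ a, matrixForm (A y) v (X a y) • X a y = v)
    (hu : ContDiffAt ℝ 2 u y) :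
    ∑ i, ∑ j, (A y)⁻¹ i j * (partialDeriv i (partialDeriv j u) y
      - ∑ k, ((1 / 2 : ℝ) * ∑ l, (A y)⁻¹ k l * (partialDeriv i (fun z ↦ A z j l) y
        + partialDeriv j (fun z ↦ A z i l) y - partialDeriv l (fun z ↦ A z i j) y))
        * partialDeriv k u y) =
    ∑ a, fderiv ℝ (fun z ↦ fderiv ℝ u z (X a z)) y (X a y)
      - ∑ b, (∑ a, matrixForm (A y) (VectorField.lieBracket ℝ (X b) (X a) y) (X a y))
        * fderiv ℝ u y (X b y) := by
  have hd : DifferentiableAt ℝ (fderiv ℝ u) y :=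
    (hu.fderiv_right (m := 1) le_rfl).differentiableAt one_ne_zero
  have hinv := inv_eq_sum_of_frame hsymm hspan
  have hT : ∀ a, ∑ i, ∑ j, X a y i * X a y j * partialDeriv i (partialDeriv j u) y =
      fderiv ℝ (fderiv ℝ u) y (X a y) (X a y) := by
    intro a
    rw [clm_apply_eq_sum (fderiv ℝ (fderiv ℝ u) y (X a y)), Finset.sum_comm]
    refine Finset.sum_congr rfl fun j _ ↦ ?_
    have hj : ∀ w, fderiv ℝ (partialDeriv j u) y w =
        fderiv ℝ (fderiv ℝ u) y w (EuclideanSpace.single j 1) := fun w ↦ by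
      have : partialDeriv j u = fun z ↦ fderiv ℝ u z (EuclideanSpace.single j 1) := rfl
      rw [this, fderiv_clm_apply hd (differentiableAt_const _)]
      simp
    rw [← hj, clm_apply_eq_sum, Finset.mul_sum]
    refine Finset.sum_congr rfl fun i _ ↦ ?_
    rw [partialDeriv]
    ring
  -- `X_a X_a u` is the Hessian term plus the derivative of `u` along `D_{X_a} X_a`, which is
  -- expanded in the frame.
  have hR : ∀ a, fderiv ℝ (fun z ↦ fderiv ℝ u z (X a z)) y (X a y) =
      fderiv ℝ (fderiv ℝ u) y (X a y) (X a y)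
        + ∑ b, matrixForm (A y) (fderiv ℝ (X a) y (X a y)) (X b y) * fderiv ℝ u y (X b y) := by
    intro a
    rw [fderiv_clm_apply hd (hX a)]
    have h := congrArg (fderiv ℝ u y) (hspan (fderiv ℝ (X a) y (X a y)))
    simp only [map_sum, map_smul, smul_eq_mul] at h
    rw [h, add_comm]
    rfl
  -- Koszul's formula for the frame. The term in `D_{X_a} X_a` will cancel the correction in `hR`,
  -- leaving only the bracket.
  have hC : ∀ a b, matrixForm (matrixDeriv A y (X a y)) (X a y) (X b y)
      - 1 / 2 * matrixForm (matrixDeriv A y (X b y)) (X a y) (X a y) =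
      - matrixForm (A y) (fderiv ℝ (X a) y (X a y)) (X b y)
      + matrixForm (A y) (VectorField.lieBracket ℝ (X b) (X a) y) (X a y) := by
    intro a b
    rw [matrixForm_matrixDeriv_of_frame hA (hX a) (hX b) (hon a b),
      matrixForm_matrixDeriv_of_frame hA (hX a) (hX a) (hon a a), VectorField.lieBracket,
      map_sub, LinearMap.sub_apply, matrixForm_comm hsymm (X a y) (fderiv ℝ (X b) y _),
      matrixForm_comm hsymm (X a y) (fderiv ℝ (X a) y _)]
    ring
  -- Every inverse matrix is replaced by its frame expansion; the index `a` comes from the outer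
  -- trace and `b` from the inverse inside the Christoffel symbol.
  have hL : ∀ i j, (A y)⁻¹ i j * (partialDeriv i (partialDeriv j u) y
      - ∑ k, ((1 / 2 : ℝ) * ∑ l, (A y)⁻¹ k l * (partialDeriv i (fun z ↦ A z j l) y
        + partialDeriv j (fun z ↦ A z i l) y - partialDeriv l (fun z ↦ A z i j) y))
        * partialDeriv k u y) =
      ∑ a, (X a y i * X a y j * partialDeriv i (partialDeriv j u) y
        - ∑ b, fderiv ℝ u y (X b y) * (1 / 2 * ∑ l, X a y i * X a y j * X b y l *
          (partialDeriv i (fun z ↦ A z j l) y + partialDeriv j (fun z ↦ A z i l) y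
            - partialDeriv l (fun z ↦ A z i j) y))) := by
    intro i j
    have : ∑ k, ((1 / 2 : ℝ) * ∑ l, (A y)⁻¹ k l * (partialDeriv i (fun z ↦ A z j l) y
        + partialDeriv j (fun z ↦ A z i l) y - partialDeriv l (fun z ↦ A z i j) y))
        * partialDeriv k u y = ∑ b, fderiv ℝ u y (X b y) * (1 / 2 * ∑ l, X b y l *
          (partialDeriv i (fun z ↦ A z j l) y + partialDeriv j (fun z ↦ A z i l) y
            - partialDeriv l (fun z ↦ A z i j) y)) := by
      simp only [hinv, clm_apply_eq_sum (fderiv ℝ u y) (X _ y)]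
      exact sum_mul_sum_mul_eq (fun b k ↦ X b y k) _ fun k ↦ partialDeriv k u y
    rw [this, hinv, Finset.sum_mul]
    refine Finset.sum_congr rfl fun a _ ↦ ?_
    rw [mul_sub, Finset.mul_sum]
    congr 1
    refine Finset.sum_congr rfl fun b _ ↦ ?_
    simp only [Finset.mul_sum]
    refine Finset.sum_congr rfl fun l _ ↦ ?_
    ring
  have hsum : ∀ a, ∑ i, ∑ j, (X a y i * X a y j * partialDeriv i (partialDeriv j u) y
        - ∑ b, fderiv ℝ u y (X b y) * (1 / 2 * ∑ l, X a y i * X a y j * X b y l *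
          (partialDeriv i (fun z ↦ A z j l) y + partialDeriv j (fun z ↦ A z i l) y
            - partialDeriv l (fun z ↦ A z i j) y))) =
      fderiv ℝ (fun z ↦ fderiv ℝ u z (X a z)) y (X a y) - ∑ b,
        matrixForm (A y) (VectorField.lieBracket ℝ (X b) (X a) y) (X a y)
          * fderiv ℝ u y (X b y) := by
    intro a
    simp only [Finset.sum_sub_distrib]
    rw [hT, hR, add_sub_assoc, sub_eq_add_neg, ← Finset.sum_sub_distrib]
    congr 1
    rw [Finset.sum_congr rfl fun i _ ↦ Finset.sum_comm, Finset.sum_comm,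
      ← Finset.sum_neg_distrib]
    refine Finset.sum_congr rfl fun b _ ↦ ?_
    simp only [← Finset.mul_sum]
    rw [sum_mul_christoffel_eq, ← sub_mul, mul_sub, ← mul_assoc]
    linear_combination (-fderiv ℝ u y (X b y)) * hC a b
  simp only [hL]
  rw [Finset.sum_congr rfl fun i _ ↦ Finset.sum_comm, Finset.sum_comm,
    Finset.sum_congr rfl fun a _ ↦ hsum a, Finset.sum_sub_distrib]
  congr 1
  rw [Finset.sum_comm]
  simp only [Finset.sum_mul]

end Frame

/-! ### Vector fields, brackets and the Laplacian read in a chart -/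

section Charts

variable {m : ℕ} {M : Type*} [TopologicalSpace M]
  [ChartedSpace (EuclideanSpace ℝ (Fin m)) M] [IsManifold (𝓡 m) ∞ M]

/-- The derivative of a function along a vector field. -/
noncomputable def dirDeriv (V : ∀ x : M, TangentSpace (𝓡 m) x) (f : M → ℝ) (x : M) : ℝ :=
  mfderiv (𝓡 m) 𝓘(ℝ, ℝ) f x (V x)

/-- A vector field read in the chart at a point. -/
noncomputable def chartField (p : M) (V : ∀ x : M, TangentSpace (𝓡 m) x) :
    EuclideanSpace ℝ (Fin m) → EuclideanSpace ℝ (Fin m) :=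
  VectorField.mpullbackWithin 𝓘(ℝ, EuclideanSpace ℝ (Fin m)) (𝓡 m) (extChartAt (𝓡 m) p).symm V
    (Set.range (𝓡 m))

lemma mfderiv_symm_chartField (p : M) (V : ∀ x : M, TangentSpace (𝓡 m) x)
    {z : EuclideanSpace ℝ (Fin m)} (hz : z ∈ (extChartAt (𝓡 m) p).target) :
    mfderiv (𝓡 m) (𝓡 m) (extChartAt (𝓡 m) p).symm z (chartField p V z) =
      V ((extChartAt (𝓡 m) p).symm z) := by
  have h := isInvertible_mfderivWithin_extChartAt_symm hz
  rw [chartField, VectorField.mpullbackWithin_apply]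
  rw [ModelWithCorners.range_eq_univ, mfderivWithin_univ] at h ⊢
  exact h.self_apply_inverse _

lemma mdifferentiableAt_extChartAt_symm (p : M) {z : EuclideanSpace ℝ (Fin m)}
    (hz : z ∈ (extChartAt (𝓡 m) p).target) :
    MDifferentiableAt (𝓡 m) (𝓡 m) (extChartAt (𝓡 m) p).symm z := by
  have h := mdifferentiableWithinAt_extChartAt_symm hz
  rwa [ModelWithCorners.range_eq_univ, mdifferentiableWithinAt_univ] at h

lemma differentiableAt_chartField {p : M} {V : ∀ x : M, TangentSpace (𝓡 m) x}
    (hV : MDifferentiableAt (𝓡 m) (𝓡 m).tangent (fun x ↦ (V x : TangentBundle (𝓡 m) M)) p) :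
    DifferentiableAt ℝ (chartField p V) (extChartAt (𝓡 m) p p) := by
  have h : DifferentiableWithinAt ℝ (chartField p V) _ _ := (mdifferentiableWithinAt_univ.2
    hV).differentiableWithinAt_mpullbackWithin_vectorField
  rwa [Set.preimage_univ, Set.univ_inter, ModelWithCorners.range_eq_univ,
    differentiableWithinAt_univ] at h

lemma mlieBracket_eq_mfderiv_symm (V W : ∀ x : M, TangentSpace (𝓡 m) x) (p : M) :
    VectorField.mlieBracket (𝓡 m) V W p =
      mfderiv (𝓡 m) (𝓡 m) (extChartAt (𝓡 m) p).symm (extChartAt (𝓡 m) p p)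
        (VectorField.lieBracket (E := EuclideanSpace ℝ (Fin m)) ℝ (chartField p V)
          (chartField p W) (extChartAt (𝓡 m) p p)) := by
  have hp := mem_extChartAt_source (I := 𝓡 m) p
  have h₁ := mfderivWithin_extChartAt_symm_comp_mfderiv_extChartAt' hp
  have h₂ := mfderiv_extChartAt_comp_mfderivWithin_extChartAt_symm' hp
  have h₃ : (mfderiv (𝓡 m) 𝓘(ℝ, EuclideanSpace ℝ (Fin m)) (extChartAt (𝓡 m) p) p).inverse =
      mfderiv (𝓡 m) (𝓡 m) (extChartAt (𝓡 m) p).symm (extChartAt (𝓡 m) p p) := by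
    rw [ModelWithCorners.range_eq_univ, mfderivWithin_univ] at h₁ h₂
    exact ContinuousLinearMap.inverse_eq h₂ h₁
  rw [← VectorField.mlieBracketWithin_univ, VectorField.mlieBracketWithin_apply, h₃]
  simp only [Set.preimage_univ, Set.univ_inter]
  congr 1
  have : ∀ s : Set (EuclideanSpace ℝ (Fin m)), s = Set.univ →
      VectorField.lieBracketWithin ℝ (chartField p V) (chartField p W) s (extChartAt (𝓡 m) p p) =
      VectorField.lieBracket ℝ (chartField p V) (chartField p W) (extChartAt (𝓡 m) p p) := by
    rintro s rfl
    rw [VectorField.lieBracketWithin_univ]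
  exact this _ (𝓡 m).range_eq_univ

lemma fderiv_comp_symm_chartField (p : M) (V : ∀ x : M, TangentSpace (𝓡 m) x) {f : M → ℝ}
    {z : EuclideanSpace ℝ (Fin m)} (hz : z ∈ (extChartAt (𝓡 m) p).target)
    (hf : MDifferentiableAt (𝓡 m) 𝓘(ℝ, ℝ) f ((extChartAt (𝓡 m) p).symm z)) :
    fderiv ℝ (f ∘ (extChartAt (𝓡 m) p).symm) z (chartField p V z) =
      dirDeriv V f ((extChartAt (𝓡 m) p).symm z) := by
  rw [dirDeriv, ← mfderiv_symm_chartField p V hz, ← mfderiv_eq_fderiv,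
    mfderiv_comp z hf (mdifferentiableAt_extChartAt_symm p hz)]
  rfl

lemma fderiv_comp_symm_chartField_self {p : M} {V : ∀ x : M, TangentSpace (𝓡 m) x} {f : M → ℝ}
    (hf : MDifferentiableAt (𝓡 m) 𝓘(ℝ, ℝ) f p) :
    fderiv ℝ (f ∘ (extChartAt (𝓡 m) p).symm) (extChartAt (𝓡 m) p p)
      (chartField p V (extChartAt (𝓡 m) p p)) = dirDeriv V f p := by
  have hp := extChartAt_to_inv (I := 𝓡 m) p
  exact (fderiv_comp_symm_chartField p V (mem_extChartAt_target p) (hp.symm ▸ hf)).trans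
    (congrArg (dirDeriv V f) hp)

/-- Turns the Gram matrix back into the metric, so that frame identities on the manifold become the
coordinate hypotheses of `coordLaplacian_eq_frame`. -/
lemma matrixForm_gram (g : Metric m M) (p : M) (z v w : EuclideanSpace ℝ (Fin m)) :
    matrixForm (gram g p z) v w = g.inner ((extChartAt (𝓡 m) p).symm z)
      (mfderiv (𝓡 m) (𝓡 m) (extChartAt (𝓡 m) p).symm z v)
      (mfderiv (𝓡 m) (𝓡 m) (extChartAt (𝓡 m) p).symm z w) := by
  let D : EuclideanSpace ℝ (Fin m) →L[ℝ] TangentSpace (𝓡 m) ((extChartAt (𝓡 m) p).symm z) :=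
    mfderiv (𝓡 m) (𝓡 m) (extChartAt (𝓡 m) p).symm z
  have hD : ∀ v : EuclideanSpace ℝ (Fin m), D v = ∑ i, v i • coordVector p z i := by
    intro v
    conv_lhs => rw [← (EuclideanSpace.basisFun (Fin m) ℝ).sum_repr v]
    simp only [map_sum, map_smul, EuclideanSpace.basisFun_repr, EuclideanSpace.basisFun_apply]
    rfl
  change _ = g.inner _ (D v) (D w)
  simp only [hD, map_sum, map_smul, sum_apply, smul_apply, smul_eq_mul, Finset.mul_sum]
  rw [matrixForm_apply, Finset.sum_comm]
  refine Finset.sum_congr rfl fun i _ ↦ Finset.sum_congr rfl fun j _ ↦ ?_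
  rw [gram, Matrix.of_apply]
  ring

lemma gram_comm (g : Metric m M) (p : M) (z : EuclideanSpace ℝ (Fin m)) (i j : Fin m) :
    gram g p z i j = gram g p z j i :=
  g.symm _ _ _

lemma two_le_infty : (2 : WithTop ℕ∞) ≤ ∞ := by
  have : ((2 : ℕ∞) : WithTop ℕ∞) ≤ ∞ := by exact_mod_cast le_top
  exact this

/-- The coordinate fields are images of constant fields under the tangent map of the smooth inverse
chart, and the metric is a smooth section. -/
lemma differentiableAt_gram (g : Metric m M) (p : M) (i j : Fin m) :
    DifferentiableAt ℝ (fun z ↦ gram g p z i j) (extChartAt (𝓡 m) p p) := by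
  have hsm : ContMDiffOn 𝓘(ℝ, EuclideanSpace ℝ (Fin m)) (𝓡 m) ∞ (extChartAt (𝓡 m) p).symm
    (extChartAt (𝓡 m) p).target := contMDiffOn_extChartAt_symm p
  have hopen : IsOpen (extChartAt (𝓡 m) p).target := isOpen_extChartAt_target p
  have hmem := mem_extChartAt_target (I := 𝓡 m) p
  have hcoord : ∀ i, ContMDiffAt 𝓘(ℝ, EuclideanSpace ℝ (Fin m)) (𝓡 m).tangent 1
      (fun z ↦ (⟨(extChartAt (𝓡 m) p).symm z, coordVector p z i⟩ : TangentBundle (𝓡 m) M))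
      (extChartAt (𝓡 m) p p) := by
    intro i
    have h₁ := hsm.contMDiffOn_tangentMapWithin (m := 1)
      (by rw [one_add_one_eq_two]; exact two_le_infty) hopen.uniqueMDiffOn
    have h₂ : ContMDiff 𝓘(ℝ, EuclideanSpace ℝ (Fin m))
        𝓘(ℝ, EuclideanSpace ℝ (Fin m)).tangent 1
        (fun z ↦ (⟨z, EuclideanSpace.single i (1 : ℝ)⟩ :
          TangentBundle 𝓘(ℝ, EuclideanSpace ℝ (Fin m)) (EuclideanSpace ℝ (Fin m)))) :=
      contMDiff_vectorSpace_iff_contDiff.2 contDiff_const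
    have h₃ := h₁.comp (h₂.contMDiffOn (s := (extChartAt (𝓡 m) p).target)) fun z hz ↦ hz
    refine (h₃.contMDiffAt (hopen.mem_nhds hmem)).congr_of_eventuallyEq ?_
    filter_upwards [hopen.mem_nhds hmem] with z hz
    simp only [Function.comp_apply, tangentMapWithin, coordVector]
    rw [mfderivWithin_eq_mfderiv (hopen.uniqueMDiffWithinAt hz)
      (mdifferentiableAt_extChartAt_symm p hz)]
  have hg := (g.contMDiff.of_le (m := 1) (by exact_mod_cast le_top)).contMDiffAt.comp _
    ((hsm.contMDiffAt (hopen.mem_nhds hmem)).of_le (m := 1) (by exact_mod_cast le_top))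
  have h := ContMDiffAt.clm_bundle_apply₂ (F₁ := EuclideanSpace ℝ (Fin m))
    (F₂ := EuclideanSpace ℝ (Fin m)) (F₃ := ℝ) (E₃ := Bundle.Trivial M ℝ) hg (hcoord i) (hcoord j)
  simp only [Bundle.contMDiffAt_totalSpace] at h
  exact (contMDiffAt_iff_contDiffAt.1 h.2).differentiableAt one_ne_zero

lemma contDiffAt_comp_extChartAt_symm {f : M → ℝ} {p : M}
    (hf : ContMDiffAt (𝓡 m) 𝓘(ℝ, ℝ) ∞ f p) :
    ContDiffAt ℝ 2 (f ∘ (extChartAt (𝓡 m) p).symm) (extChartAt (𝓡 m) p p) := by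
  have h := ((contMDiffOn_extChartAt_symm (I := 𝓡 m) (n := ∞) p).contMDiffAt
    (extChartAt_target_mem_nhds p))
  have h' := ContMDiffAt.comp_of_eq hf h (extChartAt_to_inv p)
  exact (contMDiffAt_iff_contDiffAt.1 h').of_le two_le_infty

lemma eventually_mdifferentiableAt {f : M → ℝ} {p : M}
    (hf : ContMDiffAt (𝓡 m) 𝓘(ℝ, ℝ) ∞ f p) :
    ∀ᶠ x in nhds p, MDifferentiableAt (𝓡 m) 𝓘(ℝ, ℝ) f x :=
  ((contMDiffAt_iff_contMDiffAt_nhds (by simp)).1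
    (hf.of_le (m := 1) (by exact_mod_cast le_top))).mono
      fun _ hx ↦ hx.mdifferentiableAt one_ne_zero

lemma eventually_fderiv_comp_symm_chartField {f : M → ℝ} {p : M}
    (hf : ContMDiffAt (𝓡 m) 𝓘(ℝ, ℝ) ∞ f p) (V : ∀ x : M, TangentSpace (𝓡 m) x) :
    (fun z ↦ fderiv ℝ (f ∘ (extChartAt (𝓡 m) p).symm) z (chartField p V z))
      =ᶠ[nhds (extChartAt (𝓡 m) p p)] dirDeriv V f ∘ (extChartAt (𝓡 m) p).symm := by
  have hc := (continuousAt_extChartAt_symm (I := 𝓡 m) p).eventually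
    ((extChartAt_to_inv (I := 𝓡 m) p).symm ▸ eventually_mdifferentiableAt hf)
  filter_upwards [extChartAt_target_mem_nhds p, hc] with z hz hfz
  exact fderiv_comp_symm_chartField p V hz hfz

/-- The derivative of a smooth function along a differentiable vector field is differentiable. -/
lemma mdifferentiableAt_dirDeriv {f : M → ℝ} {p : M} {V : ∀ x : M, TangentSpace (𝓡 m) x}
    (hf : ContMDiffAt (𝓡 m) 𝓘(ℝ, ℝ) ∞ f p)
    (hV : MDifferentiableAt (𝓡 m) (𝓡 m).tangent (fun x ↦ (V x : TangentBundle (𝓡 m) M)) p) :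
    MDifferentiableAt (𝓡 m) 𝓘(ℝ, ℝ) (dirDeriv V f) p := by
  have hd : DifferentiableAt ℝ (dirDeriv V f ∘ (extChartAt (𝓡 m) p).symm)
      (extChartAt (𝓡 m) p p) := by
    refine DifferentiableAt.congr_of_eventuallyEq ?_
      (eventually_fderiv_comp_symm_chartField hf V).symm
    exact (((contDiffAt_comp_extChartAt_symm hf).fderiv_right (m := 1)
      le_rfl).differentiableAt one_ne_zero).clm_apply (differentiableAt_chartField hV)
  have h := hd.mdifferentiableAt.comp p
    (mdifferentiableAt_extChartAt (I := 𝓡 m) (mem_chart_source (EuclideanSpace ℝ (Fin m)) p))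
  refine h.congr_of_eventuallyEq ?_
  filter_upwards [extChartAt_source_mem_nhds (I := 𝓡 m) p] with x hx
  exact congrArg (dirDeriv V f) ((extChartAt (𝓡 m) p).left_inv hx).symm

/-- The Laplace-Beltrami operator computed in an orthonormal frame. -/
lemma laplacian_eq_frame (g : Metric m M) {f : M → ℝ} {p : M}
    (hf : ContMDiffAt (𝓡 m) 𝓘(ℝ, ℝ) ∞ f p) {ι : Type*} [Fintype ι] [DecidableEq ι]
    {V : ι → ∀ x : M, TangentSpace (𝓡 m) x}
    (hV : ∀ a, MDifferentiableAt (𝓡 m) (𝓡 m).tangent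
      (fun x ↦ (V a x : TangentBundle (𝓡 m) M)) p)
    (hon : ∀ a b x, g.inner x (V a x) (V b x) = if a = b then 1 else 0)
    (hspan : ∀ v, ∑ a, g.inner p v (V a p) • V a p = v) :
    laplacian g f p = ∑ a, dirDeriv (V a) (dirDeriv (V a) f) p -
      ∑ b, (∑ a, g.inner p (VectorField.mlieBracket (𝓡 m) (V b) (V a) p) (V a p)) *
        dirDeriv (V b) f p := by
  set y := extChartAt (𝓡 m) p p with hy
  have hyt : y ∈ (extChartAt (𝓡 m) p).target := mem_extChartAt_target p
  have hyp : (extChartAt (𝓡 m) p).symm y = p := extChartAt_to_inv p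
  have hinj : Function.Injective (mfderiv (𝓡 m) (𝓡 m) (extChartAt (𝓡 m) p).symm y) := by
    have h := isInvertible_mfderivWithin_extChartAt_symm hyt
    rw [ModelWithCorners.range_eq_univ, mfderivWithin_univ] at h
    exact h.injective
  have key := coordLaplacian_eq_frame (A := gram g p) (y := y) (X := fun a ↦ chartField p (V a))
    (u := f ∘ (extChartAt (𝓡 m) p).symm) (differentiableAt_gram g p) (gram_comm g p y)
    (fun a ↦ differentiableAt_chartField (hV a)) ?_ ?_ (contDiffAt_comp_extChartAt_symm hf)
  · refine Eq.trans key ?_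
    -- `symm (chart p)` equals `p` only propositionally. Stating the identity for vectors of the
    -- model space allows the base point to be substituted; the same device recurs below.
    have hq : ∀ q, q = p → ∀ (w : EuclideanSpace ℝ (Fin m)) (a : ι),
        g.inner q w (V a q) = g.inner p w (V a p) := by
      rintro q rfl w a
      rfl
    have hfd := hf.mdifferentiableAt (by simp)
    congr 1
    · refine Finset.sum_congr rfl fun a _ ↦ ?_
      rw [(eventually_fderiv_comp_symm_chartField hf (V a)).fderiv_eq,
        fderiv_comp_symm_chartField_self (mdifferentiableAt_dirDeriv hf (hV a))]
    · refine Finset.sum_congr rfl fun b _ ↦ ?_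
      rw [fderiv_comp_symm_chartField_self hfd]
      congr 1
      refine Finset.sum_congr rfl fun a _ ↦ ?_
      rw [matrixForm_gram, mfderiv_symm_chartField p _ hyt, mlieBracket_eq_mfderiv_symm]
      exact hq _ hyp _ a
  · intro a b
    filter_upwards [extChartAt_target_mem_nhds (I := 𝓡 m) p] with z hz
    rw [matrixForm_gram, mfderiv_symm_chartField p _ hz, mfderiv_symm_chartField p _ hz, hon]
  · intro v
    apply hinj
    have hspan' : ∀ w, ∑ a, g.inner ((extChartAt (𝓡 m) p).symm y) w
        (V a ((extChartAt (𝓡 m) p).symm y)) • V a ((extChartAt (𝓡 m) p).symm y) = w := by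
      rw [hyp]
      exact hspan
    refine Eq.trans ?_ (hspan' _)
    refine (map_sum (mfderiv (𝓡 m) (𝓡 m) (extChartAt (𝓡 m) p).symm y) _ _).trans
      (Finset.sum_congr rfl fun a _ ↦ ?_)
    refine (map_smul (mfderiv (𝓡 m) (𝓡 m) (extChartAt (𝓡 m) p).symm y) _ _).trans ?_
    rw [matrixForm_gram, mfderiv_symm_chartField p _ hyt]

end Charts

/-! ### Related vector fields and their brackets -/

section DirDeriv

variable {m n : ℕ} {M N : Type*}
  [TopologicalSpace M] [ChartedSpace (EuclideanSpace ℝ (Fin m)) M]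
  [TopologicalSpace N] [ChartedSpace (EuclideanSpace ℝ (Fin n)) N]

/-- Differentiating a pullback along a vector field related to a vector field on the target. -/
lemma dirDeriv_comp_of_related {φ : M → N} {V : ∀ x : M, TangentSpace (𝓡 m) x}
    {W : ∀ x : N, TangentSpace (𝓡 n) x} {f : N → ℝ} {x : M}
    (hφ : MDifferentiableAt (𝓡 m) (𝓡 n) φ x) (hf : MDifferentiableAt (𝓡 n) 𝓘(ℝ, ℝ) f (φ x))
    (h : mfderiv (𝓡 m) (𝓡 n) φ x (V x) = W (φ x)) :
    dirDeriv V (f ∘ φ) x = dirDeriv W f (φ x) := by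
  rw [dirDeriv, dirDeriv, ← h, mfderiv_comp x hf hφ]
  rfl

lemma dirDeriv_congr {f₁ f₂ : M → ℝ} {p : M} (h : f₁ =ᶠ[nhds p] f₂)
    (V : ∀ x : M, TangentSpace (𝓡 m) x) : dirDeriv V f₁ p = dirDeriv V f₂ p := by
  rw [dirDeriv, dirDeriv, h.mfderiv_eq]
  rfl

variable [IsManifold (𝓡 n) ∞ N]

/-- Iterated derivatives of a pullback along vector fields related to vector fields on the
target. -/
lemma dirDeriv_dirDeriv_comp_of_related {φ : M → N} {V V' : ∀ x : M, TangentSpace (𝓡 m) x}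
    {W W' : ∀ x : N, TangentSpace (𝓡 n) x} {f : N → ℝ} {p : M}
    (hφ : ContMDiff (𝓡 m) (𝓡 n) ∞ φ) (hf : ContMDiffAt (𝓡 n) 𝓘(ℝ, ℝ) ∞ f (φ p))
    (hW : MDifferentiableAt (𝓡 n) (𝓡 n).tangent (fun x ↦ (W x : TangentBundle (𝓡 n) N)) (φ p))
    (h : ∀ x, mfderiv (𝓡 m) (𝓡 n) φ x (V x) = W (φ x))
    (h' : ∀ x, mfderiv (𝓡 m) (𝓡 n) φ x (V' x) = W' (φ x)) :
    dirDeriv V' (dirDeriv V (f ∘ φ)) p = dirDeriv W' (dirDeriv W f) (φ p) := by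
  have hd := fun x ↦ hφ.mdifferentiable (by simp) x
  have hev : dirDeriv V (f ∘ φ) =ᶠ[nhds p] dirDeriv W f ∘ φ := by
    filter_upwards [hφ.continuous.continuousAt.eventually (eventually_mdifferentiableAt hf)]
      with x hx
    exact dirDeriv_comp_of_related (hd x) hx (h x)
  rw [dirDeriv_congr hev, dirDeriv_comp_of_related (hd p) (mdifferentiableAt_dirDeriv hf hW) (h' p)]

variable [IsManifold (𝓡 m) ∞ M]

lemma mfderiv_mfderiv_symm (p : M) {f : M → ℝ} (hf : MDifferentiableAt (𝓡 m) 𝓘(ℝ, ℝ) f p)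
    (w : EuclideanSpace ℝ (Fin m)) :
    mfderiv (𝓡 m) 𝓘(ℝ, ℝ) f p
      (mfderiv (𝓡 m) (𝓡 m) (extChartAt (𝓡 m) p).symm (extChartAt (𝓡 m) p p) w) =
    fderiv ℝ (f ∘ (extChartAt (𝓡 m) p).symm) (extChartAt (𝓡 m) p p) w := by
  rw [← mfderiv_eq_fderiv, mfderiv_comp_of_eq hf
    (mdifferentiableAt_extChartAt_symm p (mem_extChartAt_target p)) (extChartAt_to_inv p)]
  have hq : ∀ q, q = p → ∀ w : EuclideanSpace ℝ (Fin m),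
      (mfderiv (𝓡 m) 𝓘(ℝ, ℝ) f p w : ℝ) = mfderiv (𝓡 m) 𝓘(ℝ, ℝ) f q w := by
    rintro q rfl w
    rfl
  exact hq _ (extChartAt_to_inv p) _

/-- In a chart this is the symmetry of the second derivative of `f`, which cancels from the
commutator. -/
lemma dirDeriv_mlieBracket {f : M → ℝ} {p : M} {V W : ∀ x : M, TangentSpace (𝓡 m) x}
    (hf : ContMDiffAt (𝓡 m) 𝓘(ℝ, ℝ) ∞ f p)
    (hV : MDifferentiableAt (𝓡 m) (𝓡 m).tangent (fun x ↦ (V x : TangentBundle (𝓡 m) M)) p)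
    (hW : MDifferentiableAt (𝓡 m) (𝓡 m).tangent (fun x ↦ (W x : TangentBundle (𝓡 m) M)) p) :
    dirDeriv (VectorField.mlieBracket (𝓡 m) V W) f p =
      dirDeriv V (dirDeriv W f) p - dirDeriv W (dirDeriv V f) p := by
  rw [dirDeriv, mlieBracket_eq_mfderiv_symm,
    mfderiv_mfderiv_symm p (hf.mdifferentiableAt (by simp)),
    VectorField.fderiv_apply_lieBracket (contDiffAt_comp_extChartAt_symm hf) (by simp)
      (differentiableAt_chartField hW) (differentiableAt_chartField hV),
    (eventually_fderiv_comp_symm_chartField hf V).fderiv_eq,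
    (eventually_fderiv_comp_symm_chartField hf W).fderiv_eq,
    fderiv_comp_symm_chartField_self (mdifferentiableAt_dirDeriv hf hV),
    fderiv_comp_symm_chartField_self (mdifferentiableAt_dirDeriv hf hW)]

/-- The coordinate functions of one chart suffice as test functions. -/
lemma eq_of_forall_mfderiv_eq {p : M} {v w : TangentSpace (𝓡 m) p}
    (h : ∀ f : M → ℝ, ContMDiffAt (𝓡 m) 𝓘(ℝ, ℝ) ∞ f p →
      mfderiv (𝓡 m) 𝓘(ℝ, ℝ) f p v = mfderiv (𝓡 m) 𝓘(ℝ, ℝ) f p w) : v = w := by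
  have hinv := isInvertible_mfderiv_extChartAt (I := 𝓡 m) (mem_extChartAt_source (I := 𝓡 m) p)
  have hc : ContMDiffAt (𝓡 m) 𝓘(ℝ, EuclideanSpace ℝ (Fin m)) ∞ (extChartAt (𝓡 m) p) p :=
    contMDiffAt_extChartAt
  refine hinv.injective ?_
  refine PiLp.ext fun i ↦ ?_
  let ℓ : EuclideanSpace ℝ (Fin m) →L[ℝ] ℝ := EuclideanSpace.proj i
  have h' := h (ℓ ∘ extChartAt (𝓡 m) p) (ℓ.contMDiff.contMDiffAt.comp p hc)
  rw [mfderiv_comp p ℓ.mdifferentiableAt (hc.mdifferentiableAt (by simp)),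
    ℓ.mfderiv_eq] at h'
  exact h'

/-- Lie brackets of vector fields which are related by a map are related by this map. -/
lemma mfderiv_mlieBracket_of_related {φ : M → N} {V V' : ∀ x : M, TangentSpace (𝓡 m) x}
    {W W' : ∀ x : N, TangentSpace (𝓡 n) x} {p : M}
    (hφ : ContMDiff (𝓡 m) (𝓡 n) ∞ φ)
    (hV : MDifferentiableAt (𝓡 m) (𝓡 m).tangent (fun x ↦ (V x : TangentBundle (𝓡 m) M)) p)
    (hV' : MDifferentiableAt (𝓡 m) (𝓡 m).tangent (fun x ↦ (V' x : TangentBundle (𝓡 m) M)) p)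
    (hW : MDifferentiableAt (𝓡 n) (𝓡 n).tangent (fun x ↦ (W x : TangentBundle (𝓡 n) N)) (φ p))
    (hW' : MDifferentiableAt (𝓡 n) (𝓡 n).tangent (fun x ↦ (W' x : TangentBundle (𝓡 n) N)) (φ p))
    (h : ∀ x, mfderiv (𝓡 m) (𝓡 n) φ x (V x) = W (φ x))
    (h' : ∀ x, mfderiv (𝓡 m) (𝓡 n) φ x (V' x) = W' (φ x)) :
    mfderiv (𝓡 m) (𝓡 n) φ p (VectorField.mlieBracket (𝓡 m) V V' p) =
      VectorField.mlieBracket (𝓡 n) W W' (φ p) := by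
  -- Tested on a function `f`, both brackets are commutators of derivations, and iterated
  -- derivatives of `f ∘ φ` descend to the target.
  refine eq_of_forall_mfderiv_eq fun f hf ↦ ?_
  have h₁ := dirDeriv_mlieBracket hf hW hW'
  have h₂ := dirDeriv_mlieBracket (hf.comp p hφ.contMDiffAt) hV hV'
  rw [dirDeriv_dirDeriv_comp_of_related hφ hf hW' h' h,
    dirDeriv_dirDeriv_comp_of_related hφ hf hW h h', ← h₁, dirDeriv, dirDeriv,
    mfderiv_comp p (hf.mdifferentiableAt (by simp)) (hφ.mdifferentiable (by simp) p)] at h₂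
  exact h₂

end DirDeriv

/-! ### Left-invariant fields and homomorphisms of Lie groups -/

section LieGroup

variable {m n : ℕ} {G H : Type*} [Group G] [TopologicalSpace G]
  [ChartedSpace (EuclideanSpace ℝ (Fin m)) G] [LieGroup (𝓡 m) ∞ G]
  [Group H] [TopologicalSpace H]
  [ChartedSpace (EuclideanSpace ℝ (Fin n)) H] [LieGroup (𝓡 n) ∞ H]

variable (m n) in
/-- The map of Lie algebras induced by a homomorphism of Lie groups. -/
noncomputable def lieMap (φ : G →* H) :
    GroupLieAlgebra (𝓡 m) G →L[ℝ] GroupLieAlgebra (𝓡 n) H :=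
  mfderiv (𝓡 m) (𝓡 n) φ 1

lemma mdifferentiable_mul_left (a : G) : MDifferentiable (𝓡 m) (𝓡 m) (fun x : G ↦ a * x) :=
  (contMDiff_mul_left (n := ∞)).mdifferentiable (by simp)

lemma mfderiv_mulInvariantVectorField (φ : G →* H) (hφ : ContMDiff (𝓡 m) (𝓡 n) ∞ φ)
    (v : GroupLieAlgebra (𝓡 m) G) (x : G) :
    mfderiv (𝓡 m) (𝓡 n) φ x (mulInvariantVectorField v x) =
      mulInvariantVectorField (lieMap m n φ v) (φ x) := by
  have hd := hφ.mdifferentiable (by simp)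
  have h₁ : mfderiv (𝓡 m) (𝓡 n) (φ ∘ fun y ↦ x * y) 1 =
      (mfderiv (𝓡 m) (𝓡 n) φ (x * 1)).comp (mfderiv (𝓡 m) (𝓡 m) (fun y ↦ x * y) 1) :=
    mfderiv_comp 1 (hd _) (mdifferentiable_mul_left x 1)
  have h₂ : mfderiv (𝓡 m) (𝓡 n) ((fun y ↦ φ x * y) ∘ φ) 1 =
      (mfderiv (𝓡 n) (𝓡 n) (fun y ↦ φ x * y) (φ 1)).comp (mfderiv (𝓡 m) (𝓡 n) φ 1) :=
    mfderiv_comp 1 (mdifferentiable_mul_left _ _) (hd _)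
  -- The homomorphism property `φ ∘ L_x = L_{φ x} ∘ φ`; differentiating it at `1` gives the claim.
  have h₃ : (φ ∘ fun y ↦ x * y) = (fun y ↦ φ x * y) ∘ φ := by
    ext y
    simp
  have hx : ∀ q, q = x → ∀ w : EuclideanSpace ℝ (Fin m),
      (mfderiv (𝓡 m) (𝓡 n) φ q w : EuclideanSpace ℝ (Fin n)) = mfderiv (𝓡 m) (𝓡 n) φ x w := by
    rintro q rfl w
    rfl
  have h1 : ∀ q, q = 1 → ∀ w : EuclideanSpace ℝ (Fin n),
      (mfderiv (𝓡 n) (𝓡 n) (fun y ↦ φ x * y) q w : EuclideanSpace ℝ (Fin n)) =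
        mfderiv (𝓡 n) (𝓡 n) (fun y ↦ φ x * y) 1 w := by
    rintro q rfl w
    rfl
  have h₄ := congrArg
    (fun F : G → H ↦ (show EuclideanSpace ℝ (Fin n) from mfderiv (𝓡 m) (𝓡 n) F 1 v)) h₃
  have h₅ := (congrArg (fun T ↦ T v) h₁).symm.trans (h₄.trans (congrArg (fun T ↦ T v) h₂))
  exact (hx _ (mul_one x) _).symm.trans (h₅.trans (h1 _ (map_one φ) _))

lemma lieMap_lie (φ : G →* H) (hφ : ContMDiff (𝓡 m) (𝓡 n) ∞ φ)
    (v w : GroupLieAlgebra (𝓡 m) G) : lieMap m n φ ⁅v, w⁆ = ⁅lieMap m n φ v, lieMap m n φ w⁆ := by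
  have h := mfderiv_mlieBracket_of_related hφ (p := 1)
    (mdifferentiableAt_mulInvariantVectorField v) (mdifferentiableAt_mulInvariantVectorField w)
    (mdifferentiableAt_mulInvariantVectorField (lieMap m n φ v))
    (mdifferentiableAt_mulInvariantVectorField (lieMap m n φ w))
    (mfderiv_mulInvariantVectorField φ hφ v) (mfderiv_mulInvariantVectorField φ hφ w)
  have h1 : ∀ q, q = 1 → (VectorField.mlieBracket (𝓡 n) (mulInvariantVectorField (lieMap m n φ v))
      (mulInvariantVectorField (lieMap m n φ w)) q : EuclideanSpace ℝ (Fin n)) =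
      VectorField.mlieBracket (𝓡 n) (mulInvariantVectorField (lieMap m n φ v))
      (mulInvariantVectorField (lieMap m n φ w)) (1 : H) := by
    rintro q rfl
    rfl
  exact h.trans (h1 _ (map_one φ))

/-- The value of the Lie bracket of two left-invariant vector fields at a point. -/
lemma mlieBracket_mulInvariantVectorField (v w : GroupLieAlgebra (𝓡 m) G) (x : G) :
    VectorField.mlieBracket (𝓡 m) (mulInvariantVectorField v) (mulInvariantVectorField w) x =
      mulInvariantVectorField ⁅v, w⁆ x := by
  rw [← mulInvariantVector_mlieBracket]
  rfl

lemma IsLeftInvariant.inner_mulInvariantVectorField {g : Metric m G} (hg : IsLeftInvariant g)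
    (v w : GroupLieAlgebra (𝓡 m) G) (x : G) :
    g.inner x (mulInvariantVectorField v x) (mulInvariantVectorField w x) = g.inner 1 v w := by
  have h := hg x 1 v w
  have hx : ∀ q, q = x → ∀ w z : EuclideanSpace ℝ (Fin m),
      g.inner q w z = g.inner x w z := by
    rintro q rfl w z
    rfl
  exact (hx _ (mul_one x) _ _).symm.trans h

end LieGroup

/-! ### Submersions, immersions and tangent spaces of fibres -/

section Slices

variable {m n d : ℕ} {M N S : Type*}
  [TopologicalSpace M] [ChartedSpace (EuclideanSpace ℝ (Fin m)) M]

lemma mdifferentiable_of_mem_maximalAtlas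
    {c : OpenPartialHomeomorph M (EuclideanSpace ℝ (Fin m))}
    (hc : c ∈ IsManifold.maximalAtlas (𝓡 m) ∞ M) : c.MDifferentiable (𝓡 m) (𝓡 m) :=
  ⟨(contMDiffOn_of_mem_maximalAtlas hc).mdifferentiableOn (by simp),
    (contMDiffOn_symm_of_mem_maximalAtlas hc).mdifferentiableOn (by simp)⟩

variable [TopologicalSpace N] [ChartedSpace (EuclideanSpace ℝ (Fin n)) N]
  [TopologicalSpace S] [ChartedSpace (EuclideanSpace ℝ (Fin d)) S]

/-- Charts in which a submersion is a linear projection. -/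
lemma exists_charts_of_isSubmersionAt {φ : M → N} {p : M}
    (hφ : Manifold.IsSubmersionAt (𝓡 m) (𝓡 n) ∞ φ p) :
    ∃ (F : Type) (_ : NormedAddCommGroup F) (_ : NormedSpace ℝ F)
      (c : OpenPartialHomeomorph M (EuclideanSpace ℝ (Fin m)))
      (c' : OpenPartialHomeomorph N (EuclideanSpace ℝ (Fin n)))
      (e : EuclideanSpace ℝ (Fin m) ≃L[ℝ] EuclideanSpace ℝ (Fin n) × F),
      c.MDifferentiable (𝓡 m) (𝓡 m) ∧ c'.MDifferentiable (𝓡 n) (𝓡 n) ∧ p ∈ c.source ∧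
      φ p ∈ c'.source ∧ Set.MapsTo φ c.source c'.source ∧
      ∀ x ∈ c.source, c' (φ x) = (e (c x)).1 := by
  refine ⟨hφ.complement, inferInstance, inferInstance, hφ.domChart, hφ.codChart, hφ.equiv,
    mdifferentiable_of_mem_maximalAtlas hφ.domChart_mem_maximalAtlas,
    mdifferentiable_of_mem_maximalAtlas hφ.codChart_mem_maximalAtlas, hφ.mem_domChart_source,
    hφ.mem_codChart_source, hφ.source_subset_preimage_source, fun x hx ↦ ?_⟩
  have h := hφ.writtenInCharts (show hφ.domChart x ∈ (hφ.domChart.extend (𝓡 m)).target by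
    simp [hφ.domChart.map_source hx])
  simpa [hφ.domChart.left_inv hx] using h

/-- Charts in which an immersion is a linear injection. -/
lemma exists_charts_of_isImmersionAt {φ : M → N} {p : M}
    (hφ : Manifold.IsImmersionAt (𝓡 m) (𝓡 n) ∞ φ p) :
    ∃ (F : Type) (_ : NormedAddCommGroup F) (_ : NormedSpace ℝ F)
      (c : OpenPartialHomeomorph M (EuclideanSpace ℝ (Fin m)))
      (c' : OpenPartialHomeomorph N (EuclideanSpace ℝ (Fin n)))
      (e : (EuclideanSpace ℝ (Fin m) × F) ≃L[ℝ] EuclideanSpace ℝ (Fin n)),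
      c.MDifferentiable (𝓡 m) (𝓡 m) ∧ c'.MDifferentiable (𝓡 n) (𝓡 n) ∧ p ∈ c.source ∧
      φ p ∈ c'.source ∧ ∀ x ∈ c.source, c' (φ x) = e (c x, 0) := by
  refine ⟨hφ.complement, inferInstance, inferInstance, hφ.domChart, hφ.codChart, hφ.equiv,
    mdifferentiable_of_mem_maximalAtlas hφ.domChart_mem_maximalAtlas,
    mdifferentiable_of_mem_maximalAtlas hφ.codChart_mem_maximalAtlas, hφ.mem_domChart_source,
    hφ.mem_codChart_source, fun x hx ↦ ?_⟩
  have h := hφ.writtenInCharts (show hφ.domChart x ∈ (hφ.domChart.extend (𝓡 m)).target by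
    simp [hφ.domChart.map_source hx])
  simpa [hφ.domChart.left_inv hx] using h

lemma surjective_mfderiv_of_isSubmersionAt {φ : M → N} {p : M}
    (hφ : Manifold.IsSubmersionAt (𝓡 m) (𝓡 n) ∞ φ p) :
    Function.Surjective (mfderiv (𝓡 m) (𝓡 n) φ p) := by
  have hd : MDifferentiableAt (𝓡 m) (𝓡 n) φ p := hφ.contMDiffAt.mdifferentiableAt (by simp)
  obtain ⟨F, _, _, c, c', e, hc, hc', hp, hp', -, h⟩ := exists_charts_of_isSubmersionAt hφ
  let L : EuclideanSpace ℝ (Fin m) →L[ℝ] EuclideanSpace ℝ (Fin n) :=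
    (ContinuousLinearMap.fst ℝ _ F).comp (e : EuclideanSpace ℝ (Fin m) →L[ℝ] _)
  have hev : c' ∘ φ =ᶠ[nhds p] L ∘ c := by
    filter_upwards [c.open_source.mem_nhds hp] with x hx using h x hx
  have h₁ := hev.mfderiv_eq (I := 𝓡 m) (I' := 𝓡 n)
  rw [mfderiv_comp p (hc'.mdifferentiableAt hp') hd,
    mfderiv_comp p L.mdifferentiableAt (hc.mdifferentiableAt hp), L.mfderiv_eq] at h₁
  intro w
  obtain ⟨u, hu⟩ := hc.mfderiv_surjective hp
    (e.symm ((mfderiv (𝓡 n) (𝓡 n) c' (φ p) w : EuclideanSpace ℝ (Fin n)), 0))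
  refine ⟨u, hc'.mfderiv_injective hp' ?_⟩
  have h₂ := congrArg (fun T ↦ T u) h₁
  refine h₂.trans ?_
  change L (mfderiv (𝓡 m) (𝓡 m) c p u) = _
  rw [hu]
  exact congrArg Prod.fst (e.apply_symm_apply _)

/-- A function which vanishes on the fibre of a submersion through a point has vanishing
derivative on the kernel of the derivative of the submersion. -/
lemma mfderiv_eq_zero_of_isSubmersionAt {φ : M → N} {p : M}
    (hφ : Manifold.IsSubmersionAt (𝓡 m) (𝓡 n) ∞ φ p) {F' : Type*} [NormedAddCommGroup F']
    [NormedSpace ℝ F'] {r : M → F'} (hr : MDifferentiableAt (𝓡 m) 𝓘(ℝ, F') r p)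
    (h0 : ∀ᶠ x in nhds p, φ x = φ p → r x = 0) {v : TangentSpace (𝓡 m) p}
    (hv : mfderiv (𝓡 m) (𝓡 n) φ p v = 0) : mfderiv (𝓡 m) 𝓘(ℝ, F') r p v = 0 := by
  have hd : MDifferentiableAt (𝓡 m) (𝓡 n) φ p := hφ.contMDiffAt.mdifferentiableAt (by simp)
  obtain ⟨F, _, _, c, c', e, hc, hc', hp, hp', hmaps, h⟩ := exists_charts_of_isSubmersionAt hφ
  let L : EuclideanSpace ℝ (Fin m) →L[ℝ] EuclideanSpace ℝ (Fin n) :=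
    (ContinuousLinearMap.fst ℝ _ F).comp (e : EuclideanSpace ℝ (Fin m) →L[ℝ] _)
  have hev : c' ∘ φ =ᶠ[nhds p] L ∘ c := by
    filter_upwards [c.open_source.mem_nhds hp] with x hx using h x hx
  have h₁ := hev.mfderiv_eq (I := 𝓡 m) (I' := 𝓡 n)
  rw [mfderiv_comp p (hc'.mdifferentiableAt hp') hd,
    mfderiv_comp p L.mdifferentiableAt (hc.mdifferentiableAt hp), L.mfderiv_eq] at h₁
  let w : EuclideanSpace ℝ (Fin m) := mfderiv (𝓡 m) (𝓡 m) c p v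
  have hLw : L w = 0 := by
    have h₂ := congrArg (fun T ↦ T v) h₁
    refine h₂.symm.trans ?_
    change mfderiv (𝓡 n) (𝓡 n) c' (φ p) (mfderiv (𝓡 m) (𝓡 n) φ p v) = 0
    rw [hv]
    exact map_zero _
  have hcp : c p ∈ c.target := c.map_source hp
  have hrs : MDifferentiableAt (𝓡 m) 𝓘(ℝ, F') (r ∘ c.symm) (c p) := by
    refine MDifferentiableAt.comp (c p) ?_ (hc.mdifferentiableAt_symm hcp)
    rwa [c.left_inv hp]
  have hrc : r =ᶠ[nhds p] (r ∘ c.symm) ∘ c := by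
    filter_upwards [c.open_source.mem_nhds hp] with x hx
    simp [c.left_inv hx]
  have hrv : mfderiv (𝓡 m) 𝓘(ℝ, F') r p v = fderiv ℝ (r ∘ c.symm) (c p) w := by
    rw [hrc.mfderiv_eq, mfderiv_comp p hrs (hc.mdifferentiableAt hp)]
    exact congrArg (fun T : EuclideanSpace ℝ (Fin m) →L[ℝ] F' ↦ T w) mfderiv_eq_fderiv
  -- In the chart the fibre is a level set of the linear map `L`. Since `L w = 0`, the line through
  -- `c p` in direction `w` stays in the fibre for small `t`, so `r` vanishes along it.
  have hline : HasDerivAt (fun t : ℝ ↦ c p + t • w) w 0 := by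
    simpa using ((hasDerivAt_id (0 : ℝ)).smul_const w).const_add (c p)
  have hcomp : HasDerivAt (fun t : ℝ ↦ (r ∘ c.symm) (c p + t • w))
      (fderiv ℝ (r ∘ c.symm) (c p) w) 0 :=
    HasFDerivAt.comp_hasDerivAt_of_eq (0 : ℝ) hrs.differentiableAt.hasFDerivAt hline (by simp)
  have hzero : (fun t : ℝ ↦ (r ∘ c.symm) (c p + t • w)) =ᶠ[nhds 0] fun _ ↦ 0 := by
    have hcont : Filter.Tendsto (fun t : ℝ ↦ c p + t • w) (nhds 0) (nhds (c p)) := by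
      simpa using hline.continuousAt.tendsto
    have hsymm : Filter.Tendsto c.symm (nhds (c p)) (nhds p) := by
      simpa [c.left_inv hp] using (c.continuousAt_symm hcp).tendsto
    filter_upwards [hcont.eventually (c.open_target.mem_nhds hcp),
      (hsymm.comp hcont).eventually h0] with t ht h0t
    refine h0t (c'.injOn (hmaps (c.map_target ht)) hp' ?_)
    rw [h _ (c.map_target ht), h _ hp, c.right_inv ht]
    change L (c p + t • w) = L (c p)
    simp [hLw]
  rw [hrv]
  exact hcomp.unique ((hasDerivAt_const (0 : ℝ) (0 : F')).congr_of_eventuallyEq hzero)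

/-- Charts in which an immersion is a linear injection, with the derivatives they compute. -/
lemma exists_mfderiv_eq_of_isImmersionAt {ι : S → M} {k : S}
    (hι : Manifold.IsImmersionAt (𝓡 d) (𝓡 m) ∞ ι k) :
    ∃ (F : Type) (_ : NormedAddCommGroup F) (_ : NormedSpace ℝ F)
      (c : OpenPartialHomeomorph S (EuclideanSpace ℝ (Fin d)))
      (c' : OpenPartialHomeomorph M (EuclideanSpace ℝ (Fin m)))
      (e : (EuclideanSpace ℝ (Fin d) × F) ≃L[ℝ] EuclideanSpace ℝ (Fin m)),
      c.MDifferentiable (𝓡 d) (𝓡 d) ∧ c'.MDifferentiable (𝓡 m) (𝓡 m) ∧ k ∈ c.source ∧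
      ι k ∈ c'.source ∧ (∀ x ∈ c.source, c' (ι x) = e (c x, 0)) ∧
      ∀ u : EuclideanSpace ℝ (Fin d), mfderiv (𝓡 m) (𝓡 m) c' (ι k) (mfderiv (𝓡 d) (𝓡 m) ι k u) =
        e ((mfderiv (𝓡 d) (𝓡 d) c k u : EuclideanSpace ℝ (Fin d)), 0) := by
  have hd : MDifferentiableAt (𝓡 d) (𝓡 m) ι k := hι.contMDiffAt.mdifferentiableAt (by simp)
  obtain ⟨F, _, _, c, c', e, hc, hc', hk, hk', h⟩ := exists_charts_of_isImmersionAt hι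
  refine ⟨F, _, _, c, c', e, hc, hc', hk, hk', h, fun u ↦ ?_⟩
  let L : EuclideanSpace ℝ (Fin d) →L[ℝ] EuclideanSpace ℝ (Fin m) :=
    (e : _ →L[ℝ] EuclideanSpace ℝ (Fin m)).comp (ContinuousLinearMap.inl ℝ _ F)
  have hev : c' ∘ ι =ᶠ[nhds k] L ∘ c := by
    filter_upwards [c.open_source.mem_nhds hk] with x hx using h x hx
  have h₁ := hev.mfderiv_eq (I := 𝓡 d) (I' := 𝓡 m)
  rw [mfderiv_comp k (hc'.mdifferentiableAt hk') hd,
    mfderiv_comp k L.mdifferentiableAt (hc.mdifferentiableAt hk), L.mfderiv_eq] at h₁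
  exact congrArg (fun T ↦ T u) h₁

lemma injective_mfderiv_of_isImmersionAt {ι : S → M} {k : S}
    (hι : Manifold.IsImmersionAt (𝓡 d) (𝓡 m) ∞ ι k) :
    Function.Injective (mfderiv (𝓡 d) (𝓡 m) ι k) := by
  obtain ⟨F, _, _, c, c', e, hc, hc', hk, hk', -, h⟩ := exists_mfderiv_eq_of_isImmersionAt hι
  intro u v huv
  have h₁ := (h u).symm.trans ((congrArg (mfderiv (𝓡 m) (𝓡 m) c' (ι k)) huv).trans (h v))
  exact hc.mfderiv_injective hk (congrArg Prod.fst (e.injective h₁))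

/-- If the fibre of a submersion is contained in an embedded submanifold, then the kernel of the
derivative of the submersion is contained in the tangent space of the submanifold. -/
lemma mem_range_mfderiv_of_isSubmersionAt {ι : S → M} {k : S}
    (hι : Manifold.IsImmersionAt (𝓡 d) (𝓡 m) ∞ ι k) (hemb : Topology.IsInducing ι) {φ : M → N}
    (hφ : Manifold.IsSubmersionAt (𝓡 m) (𝓡 n) ∞ φ (ι k))
    (hfib : ∀ x, φ x = φ (ι k) → x ∈ Set.range ι) {v : TangentSpace (𝓡 m) (ι k)}
    (hv : mfderiv (𝓡 m) (𝓡 n) φ (ι k) v = 0) : ∃ u, mfderiv (𝓡 d) (𝓡 m) ι k u = v := by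
  obtain ⟨F, _, _, c, c', e, hc, hc', hk, hk', h, h'⟩ := exists_mfderiv_eq_of_isImmersionAt hι
  -- The transverse coordinates of the immersion chart: they vanish on the submanifold, hence on the
  -- fibre.
  let L : EuclideanSpace ℝ (Fin m) →L[ℝ] F :=
    (ContinuousLinearMap.snd ℝ (EuclideanSpace ℝ (Fin d)) F).comp
      (e.symm : EuclideanSpace ℝ (Fin m) →L[ℝ] _)
  have hvan : ∀ᶠ x in nhds (ι k), φ x = φ (ι k) → (L ∘ c') x = 0 := by
    have h₁ : ∀ᶠ s in nhds k, (L ∘ c') (ι s) = 0 := by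
      filter_upwards [c.open_source.mem_nhds hk] with s hs
      change L (c' (ι s)) = 0
      rw [h s hs]
      simp [L]
    -- The embedded topology is needed here: no other sheet of the image comes close to `ι k`, so
    -- every fibre point near it has its parameter near `k`.
    rw [hemb.nhds_eq_comap, Filter.eventually_comap] at h₁
    filter_upwards [h₁] with x hx hφx
    obtain ⟨s, rfl⟩ := hfib x hφx
    exact hx s rfl
  have hzero := mfderiv_eq_zero_of_isSubmersionAt hφ
    (L.mdifferentiableAt.comp (ι k) (hc'.mdifferentiableAt hk')) hvan hv
  rw [mfderiv_comp (ι k) L.mdifferentiableAt (hc'.mdifferentiableAt hk'), L.mfderiv_eq] at hzero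
  let w : EuclideanSpace ℝ (Fin m) := mfderiv (𝓡 m) (𝓡 m) c' (ι k) v
  have hw : (e.symm w).2 = 0 := hzero
  obtain ⟨u, hu⟩ := hc.mfderiv_surjective hk (e.symm w).1
  refine ⟨u, hc'.mfderiv_injective hk' ((h' u).trans ?_)⟩
  rw [hu]
  change e ((e.symm w).1, 0) = w
  rw [← hw]
  exact e.apply_symm_apply w

end Slices

end RiemannianLie

/-! ### Trace of the adjoint action on a semisimple ideal -/

section Trace

variable {L 𝔨 : Type*} [LieRing L] [LieAlgebra ℝ L] [LieRing 𝔨] [LieAlgebra ℝ 𝔨]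
  [Module.Finite ℝ 𝔨] [LieAlgebra.HasTrivialRadical ℝ 𝔨]

/-- The adjoint action on a semisimple ideal is trace-free. -/
lemma LieAlgebra.sum_bilin_lie_eq_zero {ι : Type*} [Fintype ι] [DecidableEq ι] (j : 𝔨 →ₗ⁅ℝ⁆ L)
    (hj : Function.Injective j) (hideal : ∀ (X : L) (k : 𝔨), ⁅X, j k⁆ ∈ Set.range j)
    (B : L →ₗ[ℝ] L →ₗ[ℝ] ℝ) (e : ι → L) (he : ∀ a, e a ∈ Set.range j)
    (hon : ∀ a b, B (e a) (e b) = if a = b then 1 else 0)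
    (hspan : ∀ k, ∑ a, B (j k) (e a) • e a = j k) (X : L) : ∑ a, B ⁅X, e a⁆ (e a) = 0 := by
  -- `D` is `ad X` restricted to the ideal and read on `𝔨` through `j`; by the Jacobi identity it is
  -- a derivation.
  choose D hD using hideal X
  let D' : LieDerivation ℝ 𝔨 𝔨 :=
    { toFun := D
      map_add' := fun k l ↦ hj (by simp only [hD, map_add, lie_add])
      map_smul' := fun t k ↦ hj (by simp only [hD, map_smul, lie_smul, RingHom.id_apply])
      leibniz' := fun k l ↦ hj (by
        change j (D ⁅k, l⁆) = j (⁅k, D l⁆ - ⁅l, D k⁆)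
        simp only [hD, map_sub, LieHom.map_lie]
        rw [leibniz_lie X, ← lie_skew (j l) ⁅X, j k⁆]
        abel) }
  choose f hf using he
  -- Coordinates against the orthonormal family; in the basis `f`, the sum in question is the sum of
  -- the diagonal entries of `D'`.
  let E : 𝔨 ≃ₗ[ℝ] (ι → ℝ) :=
    { toFun := fun k a ↦ B (j k) (e a)
      map_add' := fun k l ↦ by ext; simp
      map_smul' := fun t k ↦ by ext; simp
      invFun := fun t ↦ ∑ a, t a • f a
      left_inv := fun k ↦ hj (by simp [hf, hspan])
      right_inv := fun t ↦ by ext b; simp [hf, hon] }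
  let b := Module.Basis.ofEquivFun E
  have hb : ∀ a, b a = f a := fun a ↦ by
    simp [b, Module.Basis.ofEquivFun, E, Pi.single_apply]
  have h₀ := D'.trace_eq_zero_of_hasTrivialRadical
  rw [LinearMap.trace_eq_matrix_trace ℝ b] at h₀
  rw [← h₀, Matrix.trace]
  refine Finset.sum_congr rfl fun a _ ↦ ?_
  rw [Matrix.diag_apply, LinearMap.toMatrix_apply, hb, ← hf a, ← hD, hf a]
  rfl

end Trace

namespace RiemannianLie

/-! ### Left-invariant metrics from an inner product on the Lie algebra -/

section Metric

variable {n : ℕ} {H : Type*} [Group H] [TopologicalSpace H]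
  [ChartedSpace (EuclideanSpace ℝ (Fin n)) H] [LieGroup (𝓡 n) ∞ H]

/-- The left-invariant Maurer-Cartan form of a Lie group. -/
noncomputable def maurerCartan (b : H) :
    EuclideanSpace ℝ (Fin n) →L[ℝ] EuclideanSpace ℝ (Fin n) :=
  mfderiv (𝓡 n) (𝓡 n) (fun y : H ↦ b⁻¹ * y) b

lemma maurerCartan_mulInvariantVectorField (v : GroupLieAlgebra (𝓡 n) H) (b : H) :
    maurerCartan b (mulInvariantVectorField v b) = v := by
  have h₁ : (fun y : H ↦ b⁻¹ * y) ∘ (fun y ↦ b * y) = id := by ext; simp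
  have h₂ := mfderiv_comp_of_eq (I := 𝓡 n) (I' := 𝓡 n) (I'' := 𝓡 n) (x := (1 : H))
    (f := fun y ↦ b * y) (g := fun y ↦ b⁻¹ * y)
    (mdifferentiable_mul_left (m := n) b⁻¹ b) (mdifferentiable_mul_left (m := n) b 1) (mul_one b)
  rw [h₁, mfderiv_id] at h₂
  have hbase : ∀ q, q = b → ∀ w : EuclideanSpace ℝ (Fin n),
      (mfderiv (𝓡 n) (𝓡 n) (fun y : H ↦ b⁻¹ * y) q w : EuclideanSpace ℝ (Fin n)) =
        maurerCartan b w := by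
    rintro q rfl w
    rfl
  exact (hbase (b * 1) (mul_one b) _).symm.trans
    (congrArg (fun T : EuclideanSpace ℝ (Fin n) →L[ℝ] EuclideanSpace ℝ (Fin n) ↦ T v) h₂).symm

/-- The other composite is already the identity, and an injective endomorphism of a
finite-dimensional space is surjective. -/
lemma mulInvariantVectorField_maurerCartan (b : H) (v : TangentSpace (𝓡 n) b) :
    mulInvariantVectorField (I := 𝓡 n) (maurerCartan b v : GroupLieAlgebra (𝓡 n) H) b = v := by
  have hinj : Function.Injective
      (fun v : GroupLieAlgebra (𝓡 n) H ↦ mulInvariantVectorField (I := 𝓡 n) v b) :=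
    fun v w hvw ↦ by
      rw [← maurerCartan_mulInvariantVectorField v b, ← maurerCartan_mulInvariantVectorField w b]
      exact congrArg (maurerCartan b) hvw
  let T : EuclideanSpace ℝ (Fin n) →ₗ[ℝ] EuclideanSpace ℝ (Fin n) :=
    (mfderiv (𝓡 n) (𝓡 n) (fun y ↦ b * y) (1 : H)).toLinearMap
  obtain ⟨w, rfl⟩ := (LinearMap.injective_iff_surjective (f := T)).1 hinj v
  exact congrArg (fun w : GroupLieAlgebra (𝓡 n) H ↦ mulInvariantVectorField (I := 𝓡 n) w b)
    (maurerCartan_mulInvariantVectorField w b)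

/-- In an orthonormal basis all coordinates of such a `v` have modulus at most `1`, so `‖v‖ ≤ ∑ ‖e
a‖`. It supplies the boundedness field of a Riemannian metric. -/
lemma isBounded_setOf_bilin_lt_one {E : Type*} [NormedAddCommGroup E] [NormedSpace ℝ E]
    [FiniteDimensional ℝ E] (B : E →ₗ[ℝ] E →ₗ[ℝ] ℝ) (hsymm : ∀ v w, B v w = B w v)
    (hpos : ∀ v, v ≠ 0 → 0 < B v v) : Bornology.IsBounded {v | B v v < 1} := by
  obtain ⟨p, q, e, hon, hspan, -, -⟩ := exists_orthonormal_basis_sum B hsymm hpos ⊤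
  refine (Metric.isBounded_closedBall (x := (0 : E)) (r := ∑ a, ‖e a‖)).subset fun v hv ↦ ?_
  rw [mem_closedBall_zero_iff]
  have h₁ : B v v = ∑ a, B v (e a) ^ 2 := by
    conv_lhs => rw [← hspan v]
    simp only [map_sum, LinearMap.sum_apply, map_smul, LinearMap.smul_apply, smul_eq_mul]
    exact Finset.sum_congr rfl fun a _ ↦ by simp [hon, sq]
  conv_lhs => rw [← hspan v]
  refine (norm_sum_le _ _).trans (Finset.sum_le_sum fun a _ ↦ ?_)
  rw [norm_smul]
  refine mul_le_of_le_one_left (norm_nonneg _) ?_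
  rw [Real.norm_eq_abs, ← sq_le_one_iff_abs_le_one]
  refine le_trans ?_ (le_of_lt hv)
  rw [h₁]
  exact Finset.single_le_sum (f := fun a ↦ B v (e a) ^ 2) (fun _ _ ↦ sq_nonneg _)
    (Finset.mem_univ a)

open Bundle ContinuousLinearMap in
/-- An inner product on the Lie algebra extends to a left-invariant metric. -/
lemma exists_metric_inner_mulInvariantVectorField
    (Q : EuclideanSpace ℝ (Fin n) →L[ℝ] EuclideanSpace ℝ (Fin n) →L[ℝ] ℝ)
    (hsymm : ∀ v w, Q v w = Q w v) (hpos : ∀ v, v ≠ 0 → 0 < Q v v) :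
    ∃ h : Metric n H, ∀ (b : H) (v w : GroupLieAlgebra (𝓡 n) H),
      h.inner b (mulInvariantVectorField v b) (mulInvariantVectorField w b) = Q v w := by
  let q (b : H) : EuclideanSpace ℝ (Fin n) →L[ℝ] EuclideanSpace ℝ (Fin n) →L[ℝ] ℝ :=
    Q.bilinearComp (maurerCartan b) (maurerCartan b)
  have hqpos : ∀ b v, v ≠ 0 → 0 < q b v v := fun b v hv ↦ by
    refine hpos _ fun h0 ↦ hv ?_
    refine (mulInvariantVectorField_maurerCartan b v).symm.trans ((congrArg
      (fun w : GroupLieAlgebra (𝓡 n) H ↦ mulInvariantVectorField (I := 𝓡 n) w b) h0).trans ?_)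
    exact map_zero (mfderiv (𝓡 n) (𝓡 n) (fun y ↦ b * y) (1 : H))
  refine ⟨
    { inner := q
      symm := fun b v w ↦ hsymm _ _
      pos := hqpos
      isVonNBounded := fun b ↦ ?_
      contMDiff := fun b₀ ↦ ?_ }, fun b v w ↦ ?_⟩
  · refine (NormedSpace.isVonNBounded_iff ℝ (E := EuclideanSpace ℝ (Fin n))).2 ?_
    exact isBounded_setOf_bilin_lt_one (ContinuousLinearMap.toBilinForm (q b))
      (fun v w ↦ hsymm _ _) (hqpos b)
  · rw [contMDiffAt_hom_bundle]
    refine ⟨contMDiffAt_id, ?_⟩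
    -- The Maurer-Cartan form in tangent coordinates near `b₀`. It is smooth, being the partial
    -- derivative of `(x, y) ↦ x⁻¹ * y` in `y` along the diagonal.
    let A (b : H) : EuclideanSpace ℝ (Fin n) →L[ℝ] EuclideanSpace ℝ (Fin n) :=
      inTangentCoordinates (𝓡 n) (𝓡 n) id (fun x ↦ x⁻¹ * x)
        (fun x : H ↦ mfderiv (𝓡 n) (𝓡 n) (fun y : H ↦ x⁻¹ * y) x) b₀ b
    have hA : ContMDiffAt (𝓡 n) 𝓘(ℝ, EuclideanSpace ℝ (Fin n) →L[ℝ] EuclideanSpace ℝ (Fin n)) ∞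
        A b₀ :=
      ContMDiffAt.mfderiv (n := ∞) (fun x y ↦ x⁻¹ * y) id
        (contMDiff_fst.inv.mul contMDiff_snd).contMDiffAt contMDiffAt_id le_rfl
    have hQA : ContMDiffAt (𝓡 n)
        𝓘(ℝ, EuclideanSpace ℝ (Fin n) →L[ℝ] EuclideanSpace ℝ (Fin n) →L[ℝ] ℝ) ∞
        (fun b ↦ Q.bilinearComp (A b) (A b)) b₀ := by
      have hcd : ContDiff ℝ ∞ fun A : EuclideanSpace ℝ (Fin n) →L[ℝ] EuclideanSpace ℝ (Fin n) ↦
          Q.bilinearComp A A := by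
        refine contDiff_clm_apply_iff.2 fun v ↦ contDiff_clm_apply_iff.2 fun w ↦ ?_
        simp only [ContinuousLinearMap.bilinearComp_apply]
        fun_prop
      exact hcd.contMDiff.contMDiffAt.comp b₀ hA
    refine hQA.congr_of_eventuallyEq ?_
    filter_upwards [(trivializationAt (EuclideanSpace ℝ (Fin n))
      (TangentSpace (𝓡 n) : H → Type _) b₀).open_baseSet.mem_nhds
        (mem_baseSet_trivializationAt _ _ b₀)] with b hb
    ext v w
    have hb' : b ∈ (chartAt (EuclideanSpace ℝ (Fin n)) b₀).source := by simpa using hb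
    have hAb : ∀ v, A b v = maurerCartan b ((trivializationAt (EuclideanSpace ℝ (Fin n))
        (TangentSpace (𝓡 n) : H → Type _) b₀).symm b v) := by
      intro v
      have h₀ : b⁻¹ * b = b₀⁻¹ * b₀ := by simp
      have h₁ := inTangentCoordinates_eq (I := 𝓡 n) (I' := 𝓡 n) id (fun x : H ↦ x⁻¹ * x)
        maurerCartan (x := b) (x₀ := b₀) hb'
        (by simp only [inv_mul_cancel]; exact mem_chart_source _ _)
      rw [id, id, ← TangentBundle.symmL_trivializationAt_eq_core hb'] at h₁
      refine (congrArg (fun T : EuclideanSpace ℝ (Fin n) →L[ℝ] EuclideanSpace ℝ (Fin n) ↦ T v)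
        h₁).trans ?_
      -- The target point `b⁻¹ * b` is always the identity, so no coordinate change occurs on the
      -- target side.
      have h₂ : ∀ w, (tangentBundleCore (𝓡 n) H).coordChange (achart _ (b⁻¹ * b))
          (achart _ (b₀⁻¹ * b₀)) (b⁻¹ * b) w = w := by
        rw [← h₀]
        exact (tangentBundleCore (𝓡 n) H).coordChange_self _ _ (mem_achart_source _ _)
      exact (h₂ _).trans (congrArg (maurerCartan b) (Trivialization.symmL_apply _ hb v))
    refine (inCoordinates_apply_eq₂ (E₁ := (TangentSpace (𝓡 n) : H → Type _))
      (E₂ := (TangentSpace (𝓡 n) : H → Type _)) (E₃ := Bundle.Trivial H ℝ)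
      (ϕ := q b) hb hb (Set.mem_univ _)).trans ?_
    have h₃ : ∀ r : ℝ, (trivializationAt ℝ (Bundle.Trivial H ℝ) b₀).linearMapAt ℝ b r = r := by
      intro r
      simp
    refine (h₃ _).trans ?_
    rw [ContinuousLinearMap.bilinearComp_apply, hAb, hAb]
    rfl
  · change Q _ _ = _
    exact congrArg₂ (fun v w ↦ Q v w) (maurerCartan_mulInvariantVectorField v b)
      (maurerCartan_mulInvariantVectorField w b)

end Metric

/-! ### Riemannian submersions of Lie groups and their Laplacians -/

section Submersion

variable {m n : ℕ} {G H : Type*} [Group G] [TopologicalSpace G]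
  [ChartedSpace (EuclideanSpace ℝ (Fin m)) G]

lemma sum_smul_mulInvariantVectorField {ι : Type*} [Fintype ι] (c : ι → ℝ)
    (v : ι → GroupLieAlgebra (𝓡 m) G) (x : G) :
    ∑ a, c a • mulInvariantVectorField (v a) x = mulInvariantVectorField (∑ a, c a • v a) x := by
  have h := map_sum (mfderiv (𝓡 m) (𝓡 m) (fun y ↦ x * y) (1 : G)) (fun a ↦ c a • v a) Finset.univ
  refine Eq.trans ?_ h.symm
  exact Finset.sum_congr rfl fun a _ ↦ (map_smul _ (c a) (v a)).symm

variable [LieGroup (𝓡 m) ∞ G]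

lemma exists_mulInvariantVectorField_eq (x : G) (v : TangentSpace (𝓡 m) x) :
    ∃ v' : GroupLieAlgebra (𝓡 m) G, mulInvariantVectorField v' x = v :=
  ⟨_, mulInvariantVectorField_maurerCartan x v⟩

lemma mulInvariantVectorField_eq_zero_iff {v : GroupLieAlgebra (𝓡 m) G} {x : G} :
    mulInvariantVectorField v x = 0 ↔ v = 0 := by
  constructor
  · intro h
    exact (maurerCartan_mulInvariantVectorField v x).symm.trans
      ((congrArg (maurerCartan x) h).trans (map_zero _))
  · rintro rfl
    exact map_zero (mfderiv (𝓡 m) (𝓡 m) (fun y ↦ x * y) (1 : G))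

/-- The inner product on the Lie algebra given by a Riemannian metric. -/
noncomputable def innerForm (g : Metric m G) :
    GroupLieAlgebra (𝓡 m) G →ₗ[ℝ] GroupLieAlgebra (𝓡 m) G →ₗ[ℝ] ℝ :=
  ContinuousLinearMap.toBilinForm (g.inner 1)

lemma innerForm_symm (g : Metric m G) (v w : GroupLieAlgebra (𝓡 m) G) :
    innerForm g v w = innerForm g w v := g.symm 1 v w

lemma innerForm_pos (g : Metric m G) (v : GroupLieAlgebra (𝓡 m) G) (hv : v ≠ 0) :
    0 < innerForm g v v := g.pos 1 v hv

variable [Group H] [TopologicalSpace H] [ChartedSpace (EuclideanSpace ℝ (Fin n)) H]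

variable (n) in
/-- Vectors in the Lie algebra orthogonal to the kernel of a homomorphism. -/
def IsHorizontal (g : Metric m G) (φ : G →* H) (v : GroupLieAlgebra (𝓡 m) G) : Prop :=
  ∀ u, lieMap m n φ u = 0 → innerForm g v u = 0

lemma IsHorizontal.add {g : Metric m G} {φ : G →* H} {v w : GroupLieAlgebra (𝓡 m) G}
    (hv : IsHorizontal n g φ v) (hw : IsHorizontal n g φ w) : IsHorizontal n g φ (v + w) :=
  fun u hu ↦ by rw [map_add, LinearMap.add_apply, hv u hu, hw u hu, add_zero]

lemma IsHorizontal.smul {g : Metric m G} {φ : G →* H} {v : GroupLieAlgebra (𝓡 m) G}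
    (hv : IsHorizontal n g φ v) (t : ℝ) : IsHorizontal n g φ (t • v) :=
  fun u hu ↦ by rw [map_smul, LinearMap.smul_apply, hv u hu, smul_zero]

variable (n) in
/-- An orthonormal basis of the Lie algebra consisting of horizontal and vertical vectors. -/
structure IsAdaptedBasis (g : Metric m G) (φ : G →* H) {p q : ℕ}
    (e : Fin p ⊕ Fin q → GroupLieAlgebra (𝓡 m) G) : Prop where
  orthonormal : ∀ a b, innerForm g (e a) (e b) = if a = b then 1 else 0
  sum_smul : ∀ v, ∑ a, innerForm g v (e a) • e a = v
  vertical : ∀ a, lieMap m n φ (e (Sum.inr a)) = 0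
  horizontal : ∀ a, IsHorizontal n g φ (e (Sum.inl a))

lemma exists_isAdaptedBasis (g : Metric m G) (φ : G →* H) :
    ∃ (p q : ℕ) (e : Fin p ⊕ Fin q → GroupLieAlgebra (𝓡 m) G), IsAdaptedBasis n g φ e := by
  have : FiniteDimensional ℝ (GroupLieAlgebra (𝓡 m) G) :=
    inferInstanceAs (FiniteDimensional ℝ (EuclideanSpace ℝ (Fin m)))
  obtain ⟨p, q, e, h₁, h₂, h₃, h₄⟩ := exists_orthonormal_basis_sum (innerForm g)
    (innerForm_symm g) (innerForm_pos g) (LinearMap.ker (lieMap m n φ).toLinearMap)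
  exact ⟨p, q, e, h₁, h₂, h₃, fun a u hu ↦ (innerForm_symm g _ _).trans (h₄ u hu a)⟩

namespace IsAdaptedBasis

variable {g : Metric m G} {φ : G →* H} {p q : ℕ}
  {e : Fin p ⊕ Fin q → GroupLieAlgebra (𝓡 m) G}

lemma lieMap_sum (he : IsAdaptedBasis n g φ e) (v : GroupLieAlgebra (𝓡 m) G) :
    ∑ a, innerForm g v (e (Sum.inl a)) • lieMap m n φ (e (Sum.inl a)) = lieMap m n φ v := by
  conv_rhs => rw [← he.sum_smul v]
  simp [he.vertical]

/-- Orthogonal projection onto the horizontal space. -/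
lemma exists_isHorizontal (he : IsAdaptedBasis n g φ e) (v : GroupLieAlgebra (𝓡 m) G) :
    ∃ w, IsHorizontal n g φ w ∧ lieMap m n φ w = lieMap m n φ v := by
  refine ⟨∑ a, innerForm g v (e (Sum.inl a)) • e (Sum.inl a), fun u hu ↦ ?_, ?_⟩
  · simp [he.horizontal _ u hu]
  · simpa using he.lieMap_sum v

end IsAdaptedBasis

lemma IsHorizontal.eq_of_lieMap_eq {g : Metric m G} {φ : G →* H} {v w : GroupLieAlgebra (𝓡 m) G}
    (hv : IsHorizontal n g φ v) (hw : IsHorizontal n g φ w)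
    (h : lieMap m n φ v = lieMap m n φ w) : v = w := by
  by_contra hne
  have h₀ : lieMap m n φ (v - w) = 0 := by rw [map_sub, h, sub_self]
  refine (innerForm_pos g (v - w) (sub_ne_zero.2 hne)).ne' ?_
  rw [(innerForm g).map_sub, LinearMap.sub_apply, hv _ h₀, hw _ h₀, sub_zero]

/-- The inner product induced on the Lie algebra of the target of a submersion. -/
lemma exists_inner_lieMap (g : Metric m G) (φ : G →* H)
    (hsurj : Function.Surjective (lieMap m n φ)) :
    ∃ Q : EuclideanSpace ℝ (Fin n) →L[ℝ] EuclideanSpace ℝ (Fin n) →L[ℝ] ℝ,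
      (∀ v w, Q v w = Q w v) ∧ (∀ v, v ≠ 0 → 0 < Q v v) ∧
      ∀ v w, IsHorizontal n g φ v → IsHorizontal n g φ w →
        Q (lieMap m n φ v) (lieMap m n φ w) = innerForm g v w := by
  obtain ⟨p, q, e, he⟩ := exists_isAdaptedBasis (n := n) g φ
  have hex : ∀ v, ∃ w, IsHorizontal n g φ w ∧ lieMap m n φ w = v := fun v ↦ by
    obtain ⟨w, rfl⟩ := hsurj v
    exact he.exists_isHorizontal w
  -- `s` is the horizontal lift; uniqueness of horizontal lifts makes it linear.
  choose s hs hs' using hex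
  let S : GroupLieAlgebra (𝓡 n) H →ₗ[ℝ] GroupLieAlgebra (𝓡 m) G :=
    { toFun := s
      map_add' := fun v w ↦ (hs _).eq_of_lieMap_eq ((hs v).add (hs w))
        (by rw [map_add, hs', hs', hs'])
      map_smul' := fun t v ↦ (hs _).eq_of_lieMap_eq ((hs v).smul t)
        (by rw [RingHom.id_apply, map_smul, hs', hs']) }
  let S' : EuclideanSpace ℝ (Fin n) →ₗ[ℝ] EuclideanSpace ℝ (Fin m) := S
  let g₁ : EuclideanSpace ℝ (Fin m) →L[ℝ] EuclideanSpace ℝ (Fin m) →L[ℝ] ℝ := g.inner 1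
  refine ⟨g₁.bilinearComp S'.toContinuousLinearMap S'.toContinuousLinearMap,
    fun v w ↦ g.symm 1 _ _, fun v hv ↦ g.pos 1 (S v) fun h0 ↦ hv ?_, fun v w hv hw ↦ ?_⟩
  · exact (hs' v).symm.trans ((congrArg (lieMap m n φ) h0).trans (map_zero _))
  · change innerForm g (s _) (s _) = _
    rw [(hs _).eq_of_lieMap_eq hv (hs' _), (hs _).eq_of_lieMap_eq hw (hs' _)]

variable [LieGroup (𝓡 n) ∞ H]

lemma mfderiv_mulInvariantVectorField_eq_zero_iff (φ : G →* H) (hφ : ContMDiff (𝓡 m) (𝓡 n) ∞ φ)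
    {v : GroupLieAlgebra (𝓡 m) G} {x : G} :
    mfderiv (𝓡 m) (𝓡 n) φ x (mulInvariantVectorField v x) = 0 ↔ lieMap m n φ v = 0 := by
  rw [mfderiv_mulInvariantVectorField φ hφ, mulInvariantVectorField_eq_zero_iff]

/-- Left-invariant fields are mapped to left-invariant fields and have constant inner products, so
horizontality at `x` is horizontality at the identity. -/
lemma isRiemannianSubmersion_iff {g : Metric m G} (hg : IsLeftInvariant g) (h : Metric n H)
    (φ : G →* H) (hφ : ContMDiff (𝓡 m) (𝓡 n) ∞ φ)
    (hsurj : ∀ x, Function.Surjective (mfderiv (𝓡 m) (𝓡 n) φ x)) :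
    IsRiemannianSubmersion g h φ ↔ ∀ x v w, IsHorizontal n g φ v → IsHorizontal n g φ w →
      h.inner (φ x) (mulInvariantVectorField (lieMap m n φ v) (φ x))
        (mulInvariantVectorField (lieMap m n φ w) (φ x)) = innerForm g v w := by
  have key (v : GroupLieAlgebra (𝓡 m) G) (x : G) : IsHorizontal n g φ v ↔
      ∀ u : TangentSpace (𝓡 m) x, mfderiv (𝓡 m) (𝓡 n) φ x u = 0 →
        g.inner x (mulInvariantVectorField v x) u = 0 := by
    constructor
    · intro hv u hu
      obtain ⟨u, rfl⟩ := exists_mulInvariantVectorField_eq x u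
      rw [hg.inner_mulInvariantVectorField]
      exact hv u ((mfderiv_mulInvariantVectorField_eq_zero_iff φ hφ).1 hu)
    · intro hv u hu
      have h₁ := hv _ ((mfderiv_mulInvariantVectorField_eq_zero_iff φ hφ).2 hu)
      rwa [hg.inner_mulInvariantVectorField] at h₁
  constructor
  · intro hh x v w hv hw
    have h₁ := hh.isometric x _ _ ((key v x).1 hv) ((key w x).1 hw)
    rwa [hg.inner_mulInvariantVectorField, mfderiv_mulInvariantVectorField φ hφ,
      mfderiv_mulInvariantVectorField φ hφ] at h₁
  · refine fun hh ↦ ⟨hφ, hsurj, fun x v w hv hw ↦ ?_⟩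
    obtain ⟨v, rfl⟩ := exists_mulInvariantVectorField_eq x v
    obtain ⟨w, rfl⟩ := exists_mulInvariantVectorField_eq x w
    rw [hg.inner_mulInvariantVectorField, mfderiv_mulInvariantVectorField φ hφ,
      mfderiv_mulInvariantVectorField φ hφ]
    exact hh x v w ((key v x).2 hv) ((key w x).2 hw)

lemma exists_isRiemannianSubmersion {g : Metric m G} (hg : IsLeftInvariant g)
    (φ : G →* H) (hφ : ContMDiff (𝓡 m) (𝓡 n) ∞ φ)
    (hsurj : ∀ x, Function.Surjective (mfderiv (𝓡 m) (𝓡 n) φ x)) :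
    ∃ h : Metric n H, IsRiemannianSubmersion g h φ := by
  obtain ⟨Q, hQ, hQ', hQ''⟩ := exists_inner_lieMap g φ (hsurj 1)
  obtain ⟨h, hh⟩ := exists_metric_inner_mulInvariantVectorField (H := H) Q hQ hQ'
  exact ⟨h, (isRiemannianSubmersion_iff hg h φ hφ hsurj).2 fun x v w hv hw ↦
    (hh _ _ _).trans (hQ'' v w hv hw)⟩

lemma Metric.ext_inner {h h' : Metric n H} (hh : ∀ b v w, h.inner b v w = h'.inner b v w) :
    h = h' := by
  have h₁ : h.inner = h'.inner := by
    ext b v w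
    exact hh b v w
  cases h
  cases h'
  congr

lemma IsAdaptedBasis.exists_isHorizontal_eq {g : Metric m G} {φ : G →* H} {p q : ℕ}
    {e : Fin p ⊕ Fin q → GroupLieAlgebra (𝓡 m) G} (he : IsAdaptedBasis n g φ e)
    (hφ : ContMDiff (𝓡 m) (𝓡 n) ∞ φ)
    (hsurj : ∀ x, Function.Surjective (mfderiv (𝓡 m) (𝓡 n) φ x)) {x : G}
    (v : TangentSpace (𝓡 n) (φ x)) : ∃ v', IsHorizontal n g φ v' ∧
      mulInvariantVectorField (lieMap m n φ v') (φ x) = v := by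
  obtain ⟨v, rfl⟩ := hsurj x v
  obtain ⟨v, rfl⟩ := exists_mulInvariantVectorField_eq x v
  obtain ⟨v', h₁, h₂⟩ := he.exists_isHorizontal v
  exact ⟨v', h₁, by rw [h₂, mfderiv_mulInvariantVectorField φ hφ]⟩

/-- Horizontal lifts exist for all tangent vectors at all points of the image, and the submersion
condition prescribes `h` on them. -/
lemma IsRiemannianSubmersion.unique {g : Metric m G} (hg : IsLeftInvariant g) {h h' : Metric n H}
    {φ : G →* H} (hφ : Function.Surjective φ) (hh : IsRiemannianSubmersion g h φ)
    (hh' : IsRiemannianSubmersion g h' φ) : h = h' := by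
  obtain ⟨p, q, e, he⟩ := exists_isAdaptedBasis (n := n) g φ
  have hs := hh.surjective_mfderiv
  have hc := hh.contMDiff
  rw [isRiemannianSubmersion_iff hg _ φ hc hs] at hh hh'
  refine Metric.ext_inner fun b v w ↦ ?_
  obtain ⟨x, rfl⟩ := hφ b
  have hex := he.exists_isHorizontal_eq hc hs (x := x)
  obtain ⟨v, hv, rfl⟩ := hex v
  obtain ⟨w, hw, rfl⟩ := hex w
  rw [hh x v w hv hw, hh' x v w hv hw]

/-- A Riemannian submersion of Lie groups preserves the Laplacian if the kernel of the map of Lie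
algebras is unimodular. -/
lemma IsRiemannianSubmersion.laplacian_comp {g : Metric m G} (hg : IsLeftInvariant g)
    {h : Metric n H} {φ : G →* H} (hφ : Function.Surjective φ)
    (hh : IsRiemannianSubmersion g h φ) {p q : ℕ}
    {e : Fin p ⊕ Fin q → GroupLieAlgebra (𝓡 m) G} (he : IsAdaptedBasis n g φ e)
    (htr : ∀ X : GroupLieAlgebra (𝓡 m) G, ∑ a, innerForm g ⁅X, e (Sum.inr a)⁆ (e (Sum.inr a)) = 0)
    {f : H → ℝ} {x : G} (hf : ContMDiffAt (𝓡 n) 𝓘(ℝ, ℝ) ∞ f (φ x)) :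
    laplacian g (f ∘ φ) x = laplacian h f (φ x) := by
  have hs := hh.surjective_mfderiv
  have hc := hh.contMDiff
  rw [isRiemannianSubmersion_iff hg _ φ hc hs] at hh
  let V a := mulInvariantVectorField (I := 𝓡 m) (e a)
  let W a := mulInvariantVectorField (I := 𝓡 n) (lieMap m n φ (e (Sum.inl a)))
  have hd := hc.mdifferentiable (by simp) x
  have hfd := hf.mdifferentiableAt (by simp)
  have hVW : ∀ a x, mfderiv (𝓡 m) (𝓡 n) φ x (V (Sum.inl a) x) = W a (φ x) :=
    fun a x ↦ mfderiv_mulInvariantVectorField φ hc _ x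
  -- Only one argument has to be horizontal: replacing `v` by its horizontal part changes it by a
  -- vertical vector, orthogonal to `w`. This is needed because brackets of horizontal vectors need
  -- not be horizontal.
  have hh' : ∀ v w, IsHorizontal n g φ w →
      h.inner (φ x) (mulInvariantVectorField (lieMap m n φ v) (φ x))
        (mulInvariantVectorField (lieMap m n φ w) (φ x)) = innerForm g v w := fun v w hw ↦ by
    obtain ⟨v', hv', hvv'⟩ := he.exists_isHorizontal v
    rw [← hvv', hh x v' w hv' hw, ← sub_eq_zero, ← LinearMap.sub_apply, ← (innerForm g).map_sub,
      innerForm_symm]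
    exact hw _ (by rw [map_sub, hvv', sub_self])
  rw [laplacian_eq_frame g (V := V) (hf.comp x hc.contMDiffAt)
      (fun a ↦ mdifferentiableAt_mulInvariantVectorField _)
      (fun a b x ↦ (hg.inner_mulInvariantVectorField _ _ x).trans (he.orthonormal a b)) ?_,
    laplacian_eq_frame h (V := W) hf (fun a ↦ mdifferentiableAt_mulInvariantVectorField _) ?_ ?_]
  · have hzero (f : H → ℝ) (y : H) :
        dirDeriv (mulInvariantVectorField (I := 𝓡 n) (0 : GroupLieAlgebra (𝓡 n) H)) f y = 0 := by
      rw [dirDeriv, mulInvariantVectorField_eq_zero_iff.2 rfl]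
      exact map_zero _
    -- Vertical fields are related to the zero field, so their contributions to both sums over
    -- derivatives vanish.
    have hV0 : ∀ a x, mfderiv (𝓡 m) (𝓡 n) φ x (V (Sum.inr a) x) =
        mulInvariantVectorField (I := 𝓡 n) (0 : GroupLieAlgebra (𝓡 n) H) (φ x) := fun a x ↦ by
      rw [mfderiv_mulInvariantVectorField φ hc, he.vertical]
    simp only [Fintype.sum_sum_type]
    congr 1
    · rw [Finset.sum_congr rfl fun a _ ↦ dirDeriv_dirDeriv_comp_of_related hc hf
          (mdifferentiableAt_mulInvariantVectorField _) (hVW a) (hVW a),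
        Finset.sum_eq_zero fun a _ ↦ (dirDeriv_dirDeriv_comp_of_related hc hf
          (mdifferentiableAt_mulInvariantVectorField 0) (hV0 a) (hV0 a)).trans (hzero _ _),
        add_zero]
    · rw [Finset.sum_eq_zero (s := Finset.univ (α := Fin q)) fun b _ ↦ by
        rw [(dirDeriv_comp_of_related hd hfd (hV0 b x)).trans (hzero _ _), mul_zero], add_zero]
      refine Finset.sum_congr rfl fun b _ ↦ ?_
      rw [dirDeriv_comp_of_related hd hfd (hVW b x)]
      congr 1
      rw [Finset.sum_congr (s₁ := Finset.univ (α := Fin q)) rfl fun a _ ↦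
        (congrArg (fun v ↦ g.inner x v (V (Sum.inr a) x))
          (mlieBracket_mulInvariantVectorField (e (Sum.inl b)) (e (Sum.inr a)) x)).trans
          (hg.inner_mulInvariantVectorField _ _ x)]
      -- The vertical part of the trace of `ad (e (Sum.inl b))` is dropped by `htr`; the horizontal
      -- part descends to the quotient.
      refine (congrArg₂ (· + ·) rfl (htr (e (Sum.inl b)))).trans ((add_zero _).trans ?_)
      refine Finset.sum_congr rfl fun a _ ↦ ?_
      rw [mlieBracket_mulInvariantVectorField, mlieBracket_mulInvariantVectorField,
        hg.inner_mulInvariantVectorField, ← lieMap_lie φ hc]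
      exact (hh' _ _ (he.horizontal a)).symm
  · intro a b y
    obtain ⟨y, rfl⟩ := hφ y
    rw [hh y _ _ (he.horizontal a) (he.horizontal b), he.orthonormal]
    simp
  · intro v
    obtain ⟨v, hv, rfl⟩ := he.exists_isHorizontal_eq hc hs v
    rw [Finset.sum_congr rfl fun a _ ↦
      congrArg (· • W a (φ x)) (hh x _ _ hv (he.horizontal a)),
      sum_smul_mulInvariantVectorField, he.lieMap_sum]
  · intro v
    obtain ⟨v, rfl⟩ := exists_mulInvariantVectorField_eq x v
    rw [Finset.sum_congr rfl fun a _ ↦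
      congrArg (· • V a x) (hg.inner_mulInvariantVectorField v (e a) x),
      sum_smul_mulInvariantVectorField]
    exact congrArg (fun v ↦ mulInvariantVectorField v x) (he.sum_smul v)

end Submersion

/-! ### The Lie algebra of the kernel -/

section Kernel

variable {m n d : ℕ} {G H S : Type*}
  [Group G] [TopologicalSpace G] [ChartedSpace (EuclideanSpace ℝ (Fin m)) G]
  [Group H] [TopologicalSpace H] [ChartedSpace (EuclideanSpace ℝ (Fin n)) H]
  [Group S] [TopologicalSpace S] [ChartedSpace (EuclideanSpace ℝ (Fin d)) S]

/-- The Lie algebra of the kernel of a submersion is the kernel of the map of Lie algebras. -/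
lemma mem_range_lieMap_iff {φ : G →* H} (hφ : Manifold.IsSubmersion (𝓡 m) (𝓡 n) ∞ φ)
    {ι : S →* G} (hι : Manifold.IsSmoothEmbedding (𝓡 d) (𝓡 m) ∞ ι) (hker : ι.range = φ.ker)
    {v : GroupLieAlgebra (𝓡 m) G} :
    v ∈ Set.range (lieMap d m ι) ↔ lieMap m n φ v = 0 := by
  have h1 : ∀ q, q = 1 → ∀ v : EuclideanSpace ℝ (Fin m),
      (mfderiv (𝓡 m) (𝓡 n) φ q v : EuclideanSpace ℝ (Fin n)) = lieMap m n φ v := by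
    rintro q rfl v
    rfl
  constructor
  · rintro ⟨u, rfl⟩
    have hcomp : φ ∘ ι = fun _ ↦ 1 := by
      ext k
      exact MonoidHom.mem_ker.1 (hker ▸ ⟨k, rfl⟩ : ι k ∈ φ.ker)
    have h₂ := mfderiv_comp (I := 𝓡 d) (I' := 𝓡 m) (I'' := 𝓡 n) (1 : S)
      (hφ.contMDiff.mdifferentiable (by simp) (ι 1)) (hι.contMDiff.mdifferentiable (by simp) 1)
    rw [hcomp, mfderiv_const] at h₂
    refine (h1 (ι 1) (map_one ι) _).symm.trans ?_
    exact (congrArg (fun T : EuclideanSpace ℝ (Fin d) →L[ℝ] EuclideanSpace ℝ (Fin n) ↦ T u)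
      h₂).symm
  · intro hv
    obtain ⟨u, hu⟩ := mem_range_mfderiv_of_isSubmersionAt (k := (1 : S))
      (hι.isImmersion.isImmersionAt 1) hι.isEmbedding.isInducing (hφ.isSubmersionAt (ι 1))
      (fun x hx ↦ by
        rw [map_one, map_one] at hx
        exact (hker ▸ MonoidHom.mem_ker.2 hx : x ∈ ι.range))
      (v := v) ((h1 (ι 1) (map_one ι) v).trans hv)
    exact ⟨u, hu⟩

variable [LieGroup (𝓡 m) ∞ G] [LieGroup (𝓡 n) ∞ H] [LieGroup (𝓡 d) ∞ S]

/-- The adjoint action on a semisimple kernel is trace-free. -/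
lemma IsAdaptedBasis.sum_innerForm_lie_eq_zero {φ : G →* H}
    (hφ : Manifold.IsSubmersion (𝓡 m) (𝓡 n) ∞ φ)
    {ι : S →* G} (hι : Manifold.IsSmoothEmbedding (𝓡 d) (𝓡 m) ∞ ι) (hker : ι.range = φ.ker)
    (hS : IsSemisimpleLieGroup d S) {g : Metric m G} {p q : ℕ}
    {e : Fin p ⊕ Fin q → GroupLieAlgebra (𝓡 m) G} (he : IsAdaptedBasis n g φ e)
    (X : GroupLieAlgebra (𝓡 m) G) :
    ∑ a, innerForm g ⁅X, e (Sum.inr a)⁆ (e (Sum.inr a)) = 0 := by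
  have : Module.Finite ℝ (GroupLieAlgebra (𝓡 d) S) :=
    inferInstanceAs (Module.Finite ℝ (EuclideanSpace ℝ (Fin d)))
  have : LieAlgebra.HasTrivialRadical ℝ (GroupLieAlgebra (𝓡 d) S) := hS
  have hmem := fun v ↦ mem_range_lieMap_iff hφ hι hker (v := v)
  let j : GroupLieAlgebra (𝓡 d) S →ₗ⁅ℝ⁆ GroupLieAlgebra (𝓡 m) G :=
    { (lieMap d m ι).toLinearMap with
      map_lie' := fun {v w} ↦ lieMap_lie ι hι.contMDiff v w }
  refine LieAlgebra.sum_bilin_lie_eq_zero j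
    (injective_mfderiv_of_isImmersionAt (hι.isImmersion.isImmersionAt 1))
    (fun X k ↦ (hmem _).2 ?_) (innerForm g) (fun a ↦ e (Sum.inr a))
    (fun a ↦ (hmem _).2 (he.vertical a)) (fun a b ↦ ?_) (fun k ↦ ?_) X
  -- The image of `j` is the kernel of a Lie algebra homomorphism, hence an ideal.
  · rw [lieMap_lie φ hφ.contMDiff, (hmem (j k)).1 ⟨k, rfl⟩, lie_zero]
  · rw [he.orthonormal]
    simp
  · have hk : ∀ a, innerForm g (j k) (e (Sum.inl a)) = 0 := fun a ↦
      (innerForm_symm g _ _).trans (he.horizontal a _ ((hmem _).1 ⟨k, rfl⟩))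
    conv_rhs => rw [← he.sum_smul (j k), Fintype.sum_sum_type]
    simp [hk]

end Kernel

end RiemannianLie

/-! ### The projection onto the quotient group -/

theorem mainTheorem2 {m d n : ℕ}
    {G : Type*} [Group G] [TopologicalSpace G]
    [ChartedSpace (EuclideanSpace ℝ (Fin m)) G] [LieGroup (𝓡 m) ∞ G]
    (g : RiemannianLie.Metric m G) (hg : RiemannianLie.IsLeftInvariant g)
    -- a normal, embedded (equivalently, closed) Lie subgroup with semisimple Lie algebra
    (K : Subgroup G) [K.Normal]
    [ChartedSpace (EuclideanSpace ℝ (Fin d)) K] [LieGroup (𝓡 d) ∞ K]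
    (hK : Manifold.IsSmoothEmbedding (𝓡 d) (𝓡 m) ∞ (Subtype.val : K → G))
    (hss : RiemannianLie.IsSemisimpleLieGroup d K)
    -- the quotient Lie group: its smooth structure is the one for which the projection
    -- is a smooth submersion
    [ChartedSpace (EuclideanSpace ℝ (Fin n)) (G ⧸ K)] [LieGroup (𝓡 n) ∞ (G ⧸ K)]
    (hπ : Manifold.IsSubmersion (𝓡 m) (𝓡 n) ∞ (QuotientGroup.mk : G → G ⧸ K)) :
    (∃! h : RiemannianLie.Metric n (G ⧸ K),
      RiemannianLie.IsRiemannianSubmersion g h (QuotientGroup.mk : G → G ⧸ K)) ∧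
    ∀ h : RiemannianLie.Metric n (G ⧸ K),
      RiemannianLie.IsRiemannianSubmersion g h (QuotientGroup.mk : G → G ⧸ K) →
      RiemannianLie.IsHarmonicMorphism g h (QuotientGroup.mk : G → G ⧸ K) := by
  have hmk : Function.Surjective (QuotientGroup.mk' K) := QuotientGroup.mk'_surjective K
  have hker : K.subtype.range = (QuotientGroup.mk' K).ker := by
    rw [Subgroup.range_subtype, QuotientGroup.ker_mk']
  have hsurj : ∀ x, Function.Surjective (mfderiv (𝓡 m) (𝓡 n) (QuotientGroup.mk' K) x) :=
    fun x ↦ RiemannianLie.surjective_mfderiv_of_isSubmersionAt (hπ.isSubmersionAt x)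
  obtain ⟨h, hh⟩ := RiemannianLie.exists_isRiemannianSubmersion hg (QuotientGroup.mk' K)
    hπ.contMDiff hsurj
  refine ⟨⟨h, hh, fun h' hh' ↦ RiemannianLie.IsRiemannianSubmersion.unique hg hmk hh' hh⟩,
    fun h hh ↦ ⟨hh.contMDiff, fun U hU _ f hf ↦
      ⟨hf.contMDiffOn.comp hh.contMDiff.contMDiffOn fun _ hx ↦ hx, fun x hx ↦ ?_⟩⟩⟩
  obtain ⟨p, q, e, he⟩ := RiemannianLie.exists_isAdaptedBasis (n := n) g (QuotientGroup.mk' K)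
  have hlap := RiemannianLie.IsRiemannianSubmersion.laplacian_comp hg hmk hh he
    (he.sum_innerForm_lie_eq_zero (ι := K.subtype) hπ hK hker hss)
    (hf.contMDiffOn.contMDiffAt (hU.mem_nhds hx))
  -- The stronger identity `Δ_g (f ∘ φ) = (Δ_h f) ∘ φ` gives harmonicity at once.
  exact hlap.trans (hf.laplacian_eq_zero _ hx)
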